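/- Let $n\ge 1$, $m\ge 0$ be integers, let $A\in\mathbb R^{n\times n}$ and $B\in\mathbb R^{n\times m}$ satisfy the Kalman condition $\mathrm{rank}(B,AB,\dots,A^{n-1}B)=n$, let $Q\in\mathbb R^{n\times n}$ and $U\in\mathbb R^{m\times m}$ be symmetric positive definite, and let $x^d,x_0\in\mathbb R^n$, $u^d\in\mathbb R^m$. Put $f(x,u)=Ax+Bu$, $f^0(x,u)=\tfrac12(x-x^d)^*Q(x-x^d)+\tfrac12(u-u^d)^*U(u-u^d)$ and $H(x,\lambda,\lambda^0,u)=\langle\lambda,f(x,u)\rangle+\lambda^0f^0(x,u)$. For $T>0$ let $(\mathrm{OCP})_T$ be the problem of minimizing $\int_0^Tf^0(x(t),u(t))\,dt$ over all $u\in L^\infty(0,T;\mathbb R^m)$ and absolutely continuous $x$ with $\dot x=Ax+Bu$ almost everywhere on $[0,T]$ and $x(0)=x_0$, where the final point is either fixed, $x(T)=x_1$ for a given $x_1\in\mathbb R^n$, or free. A normal extremal lift of an optimal pair $(x,u)$ is given by an absolutely continuous $\lambda:[0,T]\to\mathbb R^n$ with $\dot x=\partial_\lambda H$, $\dot\lambda=-\partial_xH$,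 $\partial_uH=0$ at $(x(t),\lambda(t),-1,u(t))$ for almost every $t\in[0,T]$, and with $\lambda(T)=0$ if the final point is free. Then the following hold. 1. The Riccati equation $XA+A^*X+XBU^{-1}B^*X-Q=0$ has a minimal symmetric solution $E_-$; it is negative definite, and $\sigma:=-\max\{\Re\mu\mid\mu\in\mathrm{Spec}(A+BU^{-1}B^*E_-)\}>0$. 2. The static problem of minimizing $f^0(x,u)$ subject to $Ax+Bu=0$ has a unique solution $(\bar x,\bar u)$, and there is a unique normal Lagrange multiplier, that is, a unique $\bar\lambda\in\mathbb R^n$ such that $\partial_\lambda H=0$, $\partial_xH=0$, $\partial_uH=0$ at $(\bar x,\bar\lambda,-1,\bar u)$. 3. For every $T>0$, $(\mathrm{OCP})_T$ has a unique optimal solution $(x_T,u_T)$ (controls being identified when they coincide almost everywhere), and it has a unique normal extremal lift $(x_T,\lambda_T,-1,u_T)$; the control $u_T$ has a continuous representative on $[0,T]$, which is again denoted by $u_T$. 4. Let $0<C_2<\sigma$; the value $C_2=\sigma$ is also allowed if every eigenvalue of $A+BU^{-1}B^*E_-$ of real part $-\sigma$ is semisimple (all its Jordan blocks have size one). Let $T_0>0$;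 the value $T_0=0$ is also allowed if the final point is free. Then there exists $C_1>0$ such that for every $T>0$ with $T\ge T_0$ and every $t\in[0,T]$ $$\|x_T(t)-\bar x\|+\|\lambda_T(t)-\bar\lambda\|+\|u_T(t)-\bar u\|\le C_1\left(e^{-C_2t}+e^{-C_2(T-t)}\right).$$ -/

import Mathlib

open MeasureTheory

noncomputable section

namespace LQTurnpike

/-- `ℝⁿ` with its Euclidean norm. -/
abbrev Vec (n : ℕ) := EuclideanSpace ℝ (Fin n)

/-- The product of a matrix and a column vector. -/
def act {k l : ℕ} (M : Matrix (Fin k) (Fin l) ℝ) (v : Vec l) : Vec k :=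
  WithLp.toLp 2 (M.mulVec v.ofLp)

/-- The data of a linear-quadratic problem: dynamics `A x + B u`, weights `Q`, `U` and
targets `xd`, `ud`. -/
structure Data (n m : ℕ) where
  A : Matrix (Fin n) (Fin n) ℝ
  B : Matrix (Fin n) (Fin m) ℝ
  Q : Matrix (Fin n) (Fin n) ℝ
  U : Matrix (Fin m) (Fin m) ℝ
  xd : Vec n
  ud : Vec m

/-- The final point is either fixed, `x(T) = x₁`, or free. -/
inductive FinalCondition (n : ℕ) where
  | fixed (x₁ : Vec n)
  | free

/-- The constraint on the final point of the trajectory. -/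
def FinalCondition.Holds {n : ℕ} : FinalCondition n → Vec n → Prop
  | fixed x₁, y => y = x₁
  | free, _ => True

/-- The transversality condition on the final value of the adjoint vector. -/
def FinalCondition.Transversal {n : ℕ} : FinalCondition n → Vec n → Prop
  | fixed _, _ => True
  | free, l => l = 0

/-- The block matrix `(B, AB, …, A^(n-1) B)`. -/
def kalmanMatrix {n m : ℕ} (A : Matrix (Fin n) (Fin n) ℝ) (B : Matrix (Fin n) (Fin m) ℝ) :
    Matrix (Fin n) (Fin n × Fin m) ℝ :=
  Matrix.of fun i p => (A ^ (p.1 : ℕ) * B) i p.2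

/-- The Kalman rank condition. -/
def Kalman {n m : ℕ} (A : Matrix (Fin n) (Fin n) ℝ) (B : Matrix (Fin n) (Fin m) ℝ) : Prop :=
  (kalmanMatrix A B).rank = n

/-- `y` is absolutely continuous on `[0,T]` with derivative `g` almost everywhere. -/
def IsPrimitive {k : ℕ} (T : ℝ) (g y : ℝ → Vec k) : Prop :=
  IntervalIntegrable g volume 0 T ∧ ∀ t ∈ Set.Icc 0 T, y t = y 0 + ∫ s in (0 : ℝ)..t, g s

variable {n m : ℕ}

/-- The dynamics `f(x,u) = A x + B u`. -/
def Data.f (P : Data n m) (x : Vec n) (u : Vec m) : Vec n := act P.A x + act P.B u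

/-- The running cost `f⁰(x,u) = ½ (x-xd)* Q (x-xd) + ½ (u-ud)* U (u-ud)`. -/
def Data.f0 (P : Data n m) (x : Vec n) (u : Vec m) : ℝ :=
  1 / 2 * inner ℝ (x - P.xd) (act P.Q (x - P.xd)) + 1 / 2 * inner ℝ (u - P.ud) (act P.U (u - P.ud))

/-- The Hamiltonian `H(x,λ,λ⁰,u) = ⟨λ, f(x,u)⟩ + λ⁰ f⁰(x,u)`. -/
def Data.H (P : Data n m) (x l : Vec n) (l0 : ℝ) (u : Vec m) : ℝ :=
  inner ℝ l (P.f x u) + l0 * P.f0 x u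

/-- `u ∈ L^∞(0,T)`, and `x` is a solution of `ẋ = A x + B u` on `[0,T]` satisfying the terminal
conditions. -/
def Data.Admissible (P : Data n m) (x₀ : Vec n) (F : FinalCondition n) (T : ℝ)
    (x : ℝ → Vec n) (u : ℝ → Vec m) : Prop :=
  MemLp u ⊤ (volume.restrict (Set.Icc 0 T)) ∧ ContinuousOn x (Set.Icc 0 T) ∧
    IsPrimitive T (fun t => P.f (x t) (u t)) x ∧ x 0 = x₀ ∧ F.Holds (x T)

/-- The cost functional. -/
def Data.cost (P : Data n m) (T : ℝ) (x : ℝ → Vec n) (u : ℝ → Vec m) : ℝ :=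
  ∫ t in (0 : ℝ)..T, P.f0 (x t) (u t)

/-- `(x,u)` is an optimal solution of the optimal control problem on `[0,T]`. -/
def Data.IsOptimal (P : Data n m) (x₀ : Vec n) (F : FinalCondition n) (T : ℝ)
    (x : ℝ → Vec n) (u : ℝ → Vec m) : Prop :=
  P.Admissible x₀ F T x u ∧
    ∀ x' u', P.Admissible x₀ F T x' u' → P.cost T x u ≤ P.cost T x' u'

/-- `(x,λ,-1,u)` is a normal extremal: the equations `ẋ = ∂H/∂λ`, `λ̇ = -∂H/∂x`, `∂H/∂u = 0` of
the Pontryagin maximum principle, with the transversality condition. -/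
def Data.IsNormalExtremal (P : Data n m) (F : FinalCondition n) (T : ℝ)
    (x l : ℝ → Vec n) (u : ℝ → Vec m) : Prop :=
  IsPrimitive T (fun t => gradient (fun p => P.H (x t) p (-1) (u t)) (l t)) x ∧
  IsPrimitive T (fun t => -gradient (fun y => P.H y (l t) (-1) (u t)) (x t)) l ∧
  (∀ᵐ t ∂(volume.restrict (Set.Icc 0 T)),
    gradient (fun v => P.H (x t) (l t) (-1) v) (u t) = 0) ∧
  F.Transversal (l T)

/-- `(x,λ,u)` is the unique solution on `[0,T]`: `(x,u)` is optimal with normal extremal lift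
`(x,λ,-1,u)`; every optimal pair coincides with `(x,u)` and every normal extremal lift of an
optimal pair coincides with `(x,λ,-1,u)`. Controls are classes of functions modulo
almost everywhere equality; `u` is the continuous representative. -/
def Data.IsUniqueSolution (P : Data n m) (x₀ : Vec n) (F : FinalCondition n) (T : ℝ)
    (x l : ℝ → Vec n) (u : ℝ → Vec m) : Prop :=
  P.IsOptimal x₀ F T x u ∧ P.IsNormalExtremal F T x l u ∧ ContinuousOn u (Set.Icc 0 T) ∧
  (∀ x' u', P.IsOptimal x₀ F T x' u' →
    Set.EqOn x' x (Set.Icc 0 T) ∧ u' =ᵐ[volume.restrict (Set.Icc 0 T)] u) ∧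
  (∀ x' l' u', P.IsOptimal x₀ F T x' u' → P.IsNormalExtremal F T x' l' u' →
    Set.EqOn l' l (Set.Icc 0 T))

/-- `(x,u)` solves the static problem: minimize `f⁰` subject to `f(x,u) = 0`. -/
def Data.IsStaticOptimal (P : Data n m) (x : Vec n) (u : Vec m) : Prop :=
  P.f x u = 0 ∧ ∀ x' u', P.f x' u' = 0 → P.f0 x u ≤ P.f0 x' u'

/-- `(λ,-1)` is a normal Lagrange multiplier of the static problem at `(x,u)`. -/
def Data.IsStaticMultiplier (P : Data n m) (x l : Vec n) (u : Vec m) : Prop :=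
  gradient (fun p => P.H x p (-1) u) l = 0 ∧
  -gradient (fun y => P.H y l (-1) u) x = 0 ∧
  gradient (fun v => P.H x l (-1) v) u = 0

/-- `(x,u)` is the unique solution of the static problem and `(λ,-1)` its unique normal Lagrange
multiplier. -/
def Data.IsUniqueStaticSolution (P : Data n m) (x l : Vec n) (u : Vec m) : Prop :=
  P.IsStaticOptimal x u ∧ P.IsStaticMultiplier x l u ∧
  (∀ x' u', P.IsStaticOptimal x' u' → x' = x ∧ u' = u) ∧
  (∀ l', P.IsStaticMultiplier x l' u → l' = l)

/-- `X` is a symmetric solution of the algebraic Riccati equation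
`X A + A* X + X B U⁻¹ B* X - Q = 0`. -/
def Data.IsRiccati (P : Data n m) (X : Matrix (Fin n) (Fin n) ℝ) : Prop :=
  X.IsSymm ∧
    X * P.A + P.A.transpose * X + X * P.B * P.U⁻¹ * P.B.transpose * X - P.Q = 0

/-- `E` is negative definite and is the minimal symmetric solution of the Riccati equation. -/
def Data.IsEMinus (P : Data n m) (E : Matrix (Fin n) (Fin n) ℝ) : Prop :=
  P.IsRiccati E ∧ (-E).PosDef ∧ ∀ X, P.IsRiccati X → (X - E).PosSemidef

/-- The matrix `A + B U⁻¹ B* E`, seen as a complex matrix. -/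
def Data.closedLoop (P : Data n m) (E : Matrix (Fin n) (Fin n) ℝ) : Matrix (Fin n) (Fin n) ℂ :=
  (P.A + P.B * P.U⁻¹ * P.B.transpose * E).map Complex.ofReal

/-- The generalized eigenvectors of `M` for `μ` are eigenvectors, that is, every Jordan block of
`M` for `μ` has size one. -/
def IsSemisimpleAt (M : Matrix (Fin n) (Fin n) ℂ) (μ : ℂ) : Prop :=
  ∀ v : Fin n → ℂ, ((M - Matrix.scalar (Fin n) μ) ^ 2).mulVec v = 0 →
    (M - Matrix.scalar (Fin n) μ).mulVec v = 0

end LQTurnpike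

end

/-! Write S = B U⁻¹ B*. Once the control is eliminated, the deviation (x, l) of an extremal from the
static one solves x' = A x + S l, l' = Q x - A* l, and along this Hamiltonian system ⟪l, x⟫ has
derivative ⟪Q x, x⟫ + ⟪S l, l⟫ ≥ 0. If ⟪l, x⟫ does not increase between two times, then x = 0 and B*
l = 0 in between, and the Kalman condition forces l = 0 (`LQSystem.IsSol.eq_zero`). This one fact
gives injectivity, hence in finite dimension solvability, of all the boundary value problems below
and of the static equations.

The condition l(T) = 0 reads l(0) = E_T x(0) with E_T symmetric and negative definite. The forms of
E_T decrease with T and are bounded below, because the origin can be reached in time one. Their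
limit E has a flow-invariant graph, which is the Riccati equation (`LQSystem.exists_isRiccati_neg`).
Time reversal gives a positive definite solution F (`LQSystem.exists_isRiccati_pos`). A Lyapunov
identity makes A + S E stable (`LQSystem.IsRiccati.re_neg`), and stability makes E minimal
(`LQSystem.IsRiccati.inner_sub_nonneg`).

Extremals are sought as a part on the graph of E, started at time 0, plus a part on the graph of F,
prescribed at time T. Since F - E conjugates A + S F to -(A + S E)*, the second part decays backward
at the rate at which the first decays forward. The operator sending the two components to the
boundary data is invertible, continuous in T, and has an invertible limit as T → ∞. Its inverse is
therefore bounded uniformly in T ≥ T₀, which is the turnpike estimate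
(`LQSystem.exists_boundary_solution`). The admissible rates are read off the complex spectrum
(`decays_op`).

Optimality and uniqueness follow from convexity: integration by parts turns the excess cost over an
extremal into the integral of a positive definite quadratic form (`Data.IsExtremalCurve.cost_eq`).
-/

noncomputable section

namespace LQTurnpike

open scoped RealInnerProductSpace InnerProduct Topology
open Filter

/-! ### Flows of linear autonomous equations -/

section LinearFlow

variable {X : Type*} [NormedAddCommGroup X] [NormedSpace ℝ X]

/-- The flow `exp (t M)` of the equation `dy/dt = M y`. -/
def linFlow (M : X →L[ℝ] X) (t : ℝ) : X →L[ℝ] X := NormedSpace.exp (t • M)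

@[simp]
lemma linFlow_zero (M : X →L[ℝ] X) : linFlow M 0 = 1 := by simp [linFlow]

variable [CompleteSpace X] (M : X →L[ℝ] X)

lemma linFlow_add (s t : ℝ) : linFlow M (s + t) = linFlow M s * linFlow M t := by
  let _ : NormedAlgebra ℚ (X →L[ℝ] X) := NormedAlgebra.restrictScalars ℚ ℝ _
  rw [linFlow, add_smul]
  exact NormedSpace.exp_add_of_commute (((Commute.refl _).smul_left _).smul_right _)

lemma linFlow_neg_apply (t : ℝ) (y : X) : linFlow M (-t) (linFlow M t y) = y := by
  rw [← mul_apply_eq_comp, ← linFlow_add]; simp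

lemma linFlow_injective (t : ℝ) : Function.Injective (linFlow M t) :=
  Function.LeftInverse.injective (linFlow_neg_apply M t)

lemma hasDerivAt_linFlow (y : X) (t : ℝ) :
    HasDerivAt (fun s => linFlow M s y) (M (linFlow M t y)) t :=
  ((hasDerivAt_exp_smul_const' M t).clm_apply (hasDerivAt_const t y)).congr_deriv (by
    simp [linFlow])

lemma continuous_linFlow : Continuous (linFlow M) :=
  continuous_iff_continuousAt.2 fun t => (hasDerivAt_exp_smul_const' M t).continuousAt

end LinearFlow

/-! ### The Hamiltonian system and its monotone pairing -/

section System

/-- If `dy/dt = L y` and `C y = 0` on an open interval, then `C L^k y = 0` there for every `k`. -/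
lemma apply_pow_eq_zero_of_hasDerivAt {V W : Type*} [NormedAddCommGroup V] [NormedSpace ℝ V]
    [NormedAddCommGroup W] [NormedSpace ℝ W] {y : ℝ → V} {L : V →L[ℝ] V} {C : V →L[ℝ] W} {a b : ℝ}
    (hy : ∀ t ∈ Set.Ioo a b, HasDerivAt y (L (y t)) t)
    (hC : ∀ t ∈ Set.Ioo a b, C (y t) = 0) (k : ℕ) :
    ∀ t ∈ Set.Ioo a b, C ((L ^ k) (y t)) = 0 := by
  induction k with
  | zero => simpa using hC
  | succ k ih =>
    intro t ht
    have h1 : HasDerivAt (fun s => C ((L ^ k) (y s))) (C ((L ^ k) (L (y t)))) t :=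
      (C.comp (L ^ k)).hasFDerivAt.comp_hasDerivAt t (hy t ht)
    have h2 : HasDerivAt (fun s => C ((L ^ k) (y s))) 0 t := by
      refine (hasDerivAt_const t (0 : W)).congr_of_eventuallyEq ?_
      filter_upwards [Ioo_mem_nhds ht.1 ht.2] with s hs using ih s hs
    rw [pow_succ]
    exact h1.unique h2

/-- The homogeneous data of a linear-quadratic problem: dynamics `A x + B u`, a state weight `Q`
and the inverse `R` of the control weight, with `(A, B)` controllable. -/
structure LQSystem (V W : Type*) [NormedAddCommGroup V] [InnerProductSpace ℝ V] [CompleteSpace V]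
    [NormedAddCommGroup W] [InnerProductSpace ℝ W] [CompleteSpace W] where
  A : V →L[ℝ] V
  B : W →L[ℝ] V
  Q : V →L[ℝ] V
  R : W →L[ℝ] W
  Q_symm : ∀ x y, ⟪Q x, y⟫ = ⟪x, Q y⟫
  Q_pos : ∀ x, x ≠ 0 → 0 < ⟪Q x, x⟫
  R_symm : ∀ x y, ⟪R x, y⟫ = ⟪x, R y⟫
  R_pos : ∀ x, x ≠ 0 → 0 < ⟪R x, x⟫
  controllable : ∀ p, (∀ k : ℕ, (B†) (((A†) ^ k) p) = 0) → p = 0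

namespace LQSystem

variable {V W : Type*} [NormedAddCommGroup V] [InnerProductSpace ℝ V] [CompleteSpace V]
  [NormedAddCommGroup W] [InnerProductSpace ℝ W] [CompleteSpace W]

variable (G : LQSystem V W)

/-- The operator `B R B*`. -/
def S : V →L[ℝ] V := G.B ∘L G.R ∘L (G.B†)

lemma S_apply (x : V) : G.S x = G.B (G.R ((G.B†) x)) := rfl

lemma inner_S (x y : V) : ⟪G.S x, y⟫ = ⟪G.R ((G.B†) x), (G.B†) y⟫ := by
  rw [S_apply, ContinuousLinearMap.adjoint_inner_right]

lemma S_symm (x y : V) : ⟪G.S x, y⟫ = ⟪x, G.S y⟫ := by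
  rw [inner_S, G.R_symm, real_inner_comm, ← inner_S, real_inner_comm]

lemma R_nonneg (x : W) : 0 ≤ ⟪G.R x, x⟫ := by
  rcases eq_or_ne x 0 with rfl | h
  · simp
  · exact (G.R_pos x h).le

lemma Q_nonneg (x : V) : 0 ≤ ⟪G.Q x, x⟫ := by
  rcases eq_or_ne x 0 with rfl | h
  · simp
  · exact (G.Q_pos x h).le

lemma S_nonneg (x : V) : 0 ≤ ⟪G.S x, x⟫ := by
  rw [inner_S]; exact G.R_nonneg _

lemma eq_zero_of_inner_Q {x : V} (h : ⟪G.Q x, x⟫ = 0) : x = 0 := by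
  by_contra hx
  exact (G.Q_pos x hx).ne' h

lemma adjoint_B_eq_zero_of_inner_S {x : V} (h : ⟪G.S x, x⟫ = 0) : (G.B†) x = 0 := by
  by_contra hx
  rw [inner_S] at h
  exact (G.R_pos _ hx).not_ge h.le

/-- A costate solving the adjoint equation, invisible through `B*` on an open interval,
vanishes there. -/
lemma costate_eq_zero {p : ℝ → V} {a b : ℝ}
    (hp : ∀ t ∈ Set.Ioo a b, HasDerivAt p (-(G.A†) (p t)) t)
    (hB : ∀ t ∈ Set.Ioo a b, (G.B†) (p t) = 0) : ∀ t ∈ Set.Ioo a b, p t = 0 := by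
  intro t ht
  refine G.controllable _ fun k => ?_
  have := apply_pow_eq_zero_of_hasDerivAt (L := -(G.A†)) (C := (G.B†)) hp hB k t ht
  rw [neg_pow] at this
  rcases neg_one_pow_eq_or (V →L[ℝ] V) k with h | h <;> simpa [h] using this

/-- `(x, l)` is a solution of the Hamiltonian system on the whole line. -/
def IsSol (x l : ℝ → V) : Prop :=
  ∀ t, HasDerivAt x (G.A (x t) + G.S (l t)) t ∧ HasDerivAt l (G.Q (x t) - (G.A†) (l t)) t

variable {G}

lemma IsSol.sub {x l y p : ℝ → V} (h : G.IsSol x l) (h' : G.IsSol y p) :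
    G.IsSol (x - y) (l - p) := by
  refine fun t => ⟨((h t).1.sub (h' t).1).congr_deriv ?_, ((h t).2.sub (h' t).2).congr_deriv ?_⟩
    <;> simp only [Pi.sub_apply, map_sub] <;> abel

/-- The contributions of A and of -A* cancel, which leaves only the Q and S terms. Taking both
solutions equal gives monotonicity; antisymmetrizing gives the conserved symplectic form. -/
lemma IsSol.hasDerivAt_inner {x l y p : ℝ → V} (h : G.IsSol x l) (h' : G.IsSol y p) (t : ℝ) :
    HasDerivAt (fun s => ⟪l s, y s⟫) (⟪G.Q (x t), y t⟫ + ⟪G.S (p t), l t⟫) t := by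
  refine ((h t).2.inner ℝ (h' t).1).congr_deriv ?_
  rw [inner_add_right, inner_sub_left, ContinuousLinearMap.adjoint_inner_left,
    real_inner_comm (l t) (G.S (p t))]
  ring

lemma IsSol.monotone {x l : ℝ → V} (h : G.IsSol x l) : Monotone fun s => ⟪l s, x s⟫ :=
  monotone_of_hasDerivAt_nonneg (fun t => h.hasDerivAt_inner h t)
    fun _ => add_nonneg (G.Q_nonneg _) (G.S_nonneg _)

lemma IsSol.symplectic {x l y p : ℝ → V} (h : G.IsSol x l) (h' : G.IsSol y p) (s t : ℝ) :
    ⟪l s, y s⟫ - ⟪p s, x s⟫ = ⟪l t, y t⟫ - ⟪p t, x t⟫ := by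
  have hd : ∀ t, HasDerivAt (fun s => ⟪l s, y s⟫ - ⟪p s, x s⟫) 0 t := fun t => by
    refine ((h.hasDerivAt_inner h' t).sub (h'.hasDerivAt_inner h t)).congr_deriv ?_
    rw [G.Q_symm, G.S_symm, real_inner_comm (x t), real_inner_comm (p t)]
    ring
  exact is_const_of_deriv_eq_zero (fun t => (hd t).differentiableAt) (fun t => (hd t).deriv) s t

/-- A Hamiltonian solution along which `⟪l, x⟫` takes the same value twice is zero in between. -/
lemma IsSol.eq_zero {x l : ℝ → V} (h : G.IsSol x l) {a b : ℝ}
    (hab : ⟪l b, x b⟫ ≤ ⟪l a, x a⟫) : ∀ t ∈ Set.Ioo a b, x t = 0 ∧ l t = 0 := by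
  -- A monotone function with no increase from a to b is constant between them.
  have hconst : ∀ t ∈ Set.Ioo a b, ⟪l t, x t⟫ = ⟪l a, x a⟫ := fun t ht =>
    le_antisymm ((h.monotone ht.2.le).trans hab) (h.monotone ht.1.le)
  have hd : ∀ t ∈ Set.Ioo a b, ⟪G.Q (x t), x t⟫ + ⟪G.S (l t), l t⟫ = 0 := fun t ht =>
    (h.hasDerivAt_inner h t).unique <|
      (hasDerivAt_const t (⟪l a, x a⟫ : ℝ)).congr_of_eventuallyEq <| by
        filter_upwards [Ioo_mem_nhds ht.1 ht.2] with s hs using hconst s hs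
  have hx : ∀ t ∈ Set.Ioo a b, x t = 0 := fun t ht =>
    G.eq_zero_of_inner_Q (by linarith [hd t ht, G.Q_nonneg (x t), G.S_nonneg (l t)])
  have hB : ∀ t ∈ Set.Ioo a b, (G.B†) (l t) = 0 := fun t ht =>
    G.adjoint_B_eq_zero_of_inner_S (by linarith [hd t ht, G.Q_nonneg (x t), G.S_nonneg (l t)])
  have hl := G.costate_eq_zero (p := l) (a := a) (b := b)
    (fun t ht => by simpa [hx t ht] using (h t).2) hB
  exact fun t ht => ⟨hx t ht, hl t ht⟩

variable (G)

/-- The Hamiltonian operator. -/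
def ham : V × V →L[ℝ] V × V :=
  (G.A.coprod G.S).prod (G.Q.coprod (-(G.A†)))

lemma ham_apply (z : V × V) : G.ham z = (G.A z.1 + G.S z.2, G.Q z.1 - (G.A†) z.2) := by
  simp [ham, sub_eq_add_neg]

/-- The flow of the Hamiltonian system. -/
def flow (t : ℝ) : V × V →L[ℝ] V × V := linFlow G.ham t

lemma isSol_flow (z : V × V) : G.IsSol (fun t => (G.flow t z).1) fun t => (G.flow t z).2 := by
  intro t
  have h : HasDerivAt (fun s => G.flow s z) _ t := hasDerivAt_linFlow G.ham z t
  rw [ham_apply] at h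
  exact ⟨(ContinuousLinearMap.fst ℝ V V).hasFDerivAt.comp_hasDerivAt t h,
    (ContinuousLinearMap.snd ℝ V V).hasFDerivAt.comp_hasDerivAt t h⟩

/-- The solution vanishes at the interior time T/2, and injectivity of the flow carries this back to
time 0. -/
lemma eq_zero_of_flow {z : V × V} {T : ℝ} (hT : 0 < T)
    (h : ⟪(G.flow T z).2, (G.flow T z).1⟫ ≤ ⟪z.2, z.1⟫) : z = 0 := by
  have h0 := (G.isSol_flow z).eq_zero (a := 0) (b := T) (by simpa [flow] using h) (T / 2)
    ⟨by linarith, by linarith⟩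
  refine linFlow_injective G.ham (T / 2) ?_
  rw [map_zero]
  exact Prod.ext h0.1 h0.2

end LQSystem

end System

/-! ### Definite solutions of the Riccati equation -/

section Riccati

/-- Symmetric operators converge pointwise as soon as their quadratic forms do. -/
lemma exists_tendsto_of_quadratic {V : Type*} [NormedAddCommGroup V] [InnerProductSpace ℝ V]
    [FiniteDimensional ℝ V] {ι : Type*} {f : Filter ι} [f.NeBot] {E : ι → V →ₗ[ℝ] V}
    (hs : ∀ᶠ i in f, ∀ x y, ⟪E i x, y⟫ = ⟪x, E i y⟫)
    (hq : ∀ x, ∃ c, Tendsto (fun i => ⟪E i x, x⟫) f (𝓝 c)) :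
    ∃ F : V →ₗ[ℝ] V, ∀ x, Tendsto (fun i => E i x) f (𝓝 (F x)) := by
  have hpol : ∀ x y, ∃ c, Tendsto (fun i => ⟪y, E i x⟫) f (𝓝 c) := fun x y => by
    -- Polarization, available because the operators are eventually symmetric.
    obtain ⟨c, hc⟩ := hq (x + y)
    obtain ⟨d, hd⟩ := hq (x - y)
    refine ⟨(c - d) / 4, ((hc.sub hd).div_const 4).congr' ?_⟩
    filter_upwards [hs] with i hi
    simp only [map_add, map_sub, inner_add_left, inner_add_right, inner_sub_left, inner_sub_right]
    rw [real_inner_comm x (E i y), real_inner_comm (E i x) y, hi x y]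
    ring
  have hlim : ∀ x, ∃ v, Tendsto (fun i => E i x) f (𝓝 v) := fun x => by
    -- In finite dimension, convergence of the coordinates in an orthonormal basis suffices.
    let b := stdOrthonormalBasis ℝ V
    choose c hc using fun j => hpol x (b j)
    refine ⟨∑ j, c j • b j, ?_⟩
    have : Tendsto (fun i => ∑ j, ⟪b j, E i x⟫ • b j) f (𝓝 (∑ j, c j • b j)) :=
      tendsto_finsetSum _ fun j _ => (hc j).smul_const _
    simpa only [b.sum_repr'] using this
  choose F hF using hlim
  exact ⟨linearMapOfTendsto F E (tendsto_pi_nhds.2 hF), hF⟩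

namespace LQSystem

variable {V W : Type*} [NormedAddCommGroup V] [InnerProductSpace ℝ V] [CompleteSpace V]
  [NormedAddCommGroup W] [InnerProductSpace ℝ W] [CompleteSpace W] (G : LQSystem V W)

/-- `E` is a symmetric solution of the algebraic Riccati equation `E A + A* E + E S E = Q`. -/
def IsRiccati (E : V →L[ℝ] V) : Prop :=
  (∀ x y, ⟪E x, y⟫ = ⟪x, E y⟫) ∧ ∀ x, E (G.A x) + (G.A†) (E x) + E (G.S (E x)) = G.Q x

lemma flow_split (T : ℝ) (x p : V) : G.flow T (x, p) = G.flow T (x, 0) + G.flow T (0, p) := by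
  rw [← map_add]; simp

/-- The family `E T` represents the condition `l T = 0` as a condition on the initial values. -/
def IsTerminal (T : ℝ) (E : V →ₗ[ℝ] V) : Prop :=
  ∀ x p, (G.flow T (x, p)).2 = 0 ↔ p = E x

variable {G}

lemma IsTerminal.flow_snd {T : ℝ} {E : V →ₗ[ℝ] V} (hE : G.IsTerminal T E) (x : V) :
    (G.flow T (x, E x)).2 = 0 := (hE x (E x)).2 rfl

/-- The symplectic form of two such solutions vanishes at T, where both costates are zero, hence
also at time 0. -/
lemma IsTerminal.symm {T : ℝ} {E : V →ₗ[ℝ] V} (hE : G.IsTerminal T E) (x y : V) :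
    ⟪E x, y⟫ = ⟪x, E y⟫ := by
  have := (G.isSol_flow (x, E x)).symplectic (G.isSol_flow (y, E y)) 0 T
  have h4 : (G.flow 0) = 1 := linFlow_zero _
  simp only [hE.flow_snd, h4, one_apply_eq_self, inner_zero_left] at this
  rw [real_inner_comm x] at this
  linarith

lemma IsTerminal.neg {T : ℝ} (hT : 0 < T) {E : V →ₗ[ℝ] V} (hE : G.IsTerminal T E) {x : V}
    (hx : x ≠ 0) : ⟪E x, x⟫ < 0 := by
  by_contra! h
  have := G.eq_zero_of_flow (z := (x, E x)) hT (by simpa [hE.flow_snd] using h)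
  exact hx (congrArg Prod.fst this)

/-- Seen from time s, the same solution has remaining horizon T - s. In the limit T → ∞ this becomes
invariance of a graph under the flow. -/
lemma IsTerminal.shift {s T : ℝ} {E E' : V →ₗ[ℝ] V} (hE : G.IsTerminal T E)
    (hE' : G.IsTerminal (T - s) E') (x : V) :
    (G.flow s (x, E x)).2 = E' (G.flow s (x, E x)).1 := by
  rw [← hE', Prod.mk.eta, flow, flow, ← mul_apply_eq_comp, ← linFlow_add, sub_add_cancel]
  exact hE.flow_snd x

lemma IsTerminal.inner_nonpos {s T : ℝ} (hs : s ≤ T) {E : V →ₗ[ℝ] V} (hE : G.IsTerminal T E)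
    (x : V) : ⟪(G.flow s (x, E x)).2, (G.flow s (x, E x)).1⟫ ≤ 0 := by
  simpa [hE.flow_snd] using (G.isSol_flow (x, E x)).monotone hs

/-- Compare the solutions (x', l') and (x, l) with the same initial state and horizons T' and T.
Monotonicity for their difference gives ⟪l'(T), x(T)⟫ ≤ ⟪l'(T), x'(T)⟫ ≤ 0, and conservation of the
symplectic form identifies the left side with the difference of the two quadratic forms. -/
lemma IsTerminal.antitone {T T' : ℝ} (hT : 0 ≤ T) (hTT' : T ≤ T') {E E' : V →ₗ[ℝ] V}
    (hE : G.IsTerminal T E) (hE' : G.IsTerminal T' E') (x : V) : ⟪E' x, x⟫ ≤ ⟪E x, x⟫ := by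
  have h1 := (G.isSol_flow (x, E' x)).symplectic (G.isSol_flow (x, E x)) 0 T
  have h2 := ((G.isSol_flow (x, E' x)).sub (G.isSol_flow (x, E x))).monotone hT
  have h3 := hE'.inner_nonpos hTT' x
  have h4 : (G.flow 0) = 1 := linFlow_zero _
  simp only [Pi.sub_apply, hE.flow_snd, h4, one_apply_eq_self, sub_self,
    inner_zero_right, sub_zero, inner_zero_left, inner_sub_right] at h1 h2
  linarith

/-- Same comparison, now against a solution whose state reaches the origin at time s. The resulting
lower bound does not depend on T. -/
lemma IsTerminal.bound {s T : ℝ} (hs : 0 ≤ s) (hsT : s ≤ T) {E : V →ₗ[ℝ] V}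
    (hE : G.IsTerminal T E) {x p : V} (hp : (G.flow s (x, p)).1 = 0) : ⟪p, x⟫ ≤ ⟪E x, x⟫ := by
  have h1 := (G.isSol_flow (x, E x)).symplectic (G.isSol_flow (x, p)) 0 s
  have h2 := ((G.isSol_flow (x, E x)).sub (G.isSol_flow (x, p))).monotone hs
  have h3 := hE.inner_nonpos hsT x
  have h4 : (G.flow 0) = 1 := linFlow_zero _
  simp only [Pi.sub_apply, hp, h4, one_apply_eq_self, sub_self,
    inner_zero_right, sub_zero, inner_sub_left] at h1 h2
  linarith

variable (G) [FiniteDimensional ℝ V]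

/-- The map from the initial costate, with zero initial state, to l(T) is injective: ⟪l, x⟫ would
vanish at both ends. It can thus be inverted to solve l(T) = 0. -/
lemma exists_isTerminal {T : ℝ} (hT : 0 < T) : ∃ E : V →ₗ[ℝ] V, G.IsTerminal T E := by
  let f : V →ₗ[ℝ] V :=
    LinearMap.snd ℝ V V ∘ₗ (G.flow T : V × V →ₗ[ℝ] V × V) ∘ₗ LinearMap.inr ℝ V V
  let g : V →ₗ[ℝ] V :=
    LinearMap.snd ℝ V V ∘ₗ (G.flow T : V × V →ₗ[ℝ] V × V) ∘ₗ LinearMap.inl ℝ V V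
  have hf : ∀ p, f p = (G.flow T (0, p)).2 := fun p => rfl
  have hg : ∀ p, g p = (G.flow T (p, 0)).2 := fun p => rfl
  have hinj : Function.Injective f := by
    refine (injective_iff_map_eq_zero f).2 fun p hp => ?_
    rw [hf] at hp
    exact congrArg Prod.snd (G.eq_zero_of_flow (z := (0, p)) hT (by simp [hp]))
  let e := LinearEquiv.ofInjectiveEndo f hinj
  refine ⟨-(e.symm.toLinearMap ∘ₗ g), fun x p => ?_⟩
  have : -(e.symm.toLinearMap ∘ₗ g) x = e.symm (-(g x)) := (map_neg e.symm (g x)).symm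
  rw [flow_split, Prod.snd_add, ← hf, ← hg, LinearMap.neg_apply, this,
    LinearEquiv.eq_symm_apply, add_eq_zero_iff_eq_neg']
  rfl

lemma exists_transfer {T : ℝ} (hT : 0 < T) (x : V) : ∃ p, (G.flow T (x, p)).1 = 0 := by
  let f : V →ₗ[ℝ] V :=
    LinearMap.fst ℝ V V ∘ₗ (G.flow T : V × V →ₗ[ℝ] V × V) ∘ₗ LinearMap.inr ℝ V V
  have hf : ∀ p, f p = (G.flow T (0, p)).1 := fun p => rfl
  have hinj : Function.Injective f := by
    refine (injective_iff_map_eq_zero f).2 fun p hp => ?_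
    rw [hf] at hp
    exact congrArg Prod.snd (G.eq_zero_of_flow (z := (0, p)) hT (by simp [hp]))
  obtain ⟨p, hp⟩ := LinearMap.injective_iff_surjective.1 hinj (-(G.flow T (x, 0)).1)
  refine ⟨p, ?_⟩
  rw [flow_split, Prod.fst_add, ← hf, hp, add_neg_cancel]

/-- The Riccati equation has a negative definite solution. -/
theorem exists_isRiccati_neg :
    ∃ E : V →L[ℝ] V, G.IsRiccati E ∧ ∀ x, x ≠ 0 → ⟪E x, x⟫ < 0 := by
  have hex : ∀ T : ℝ, ∃ E : V →ₗ[ℝ] V, 0 < T → G.IsTerminal T E := fun T => by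
    by_cases hT : 0 < T
    · obtain ⟨E, hE⟩ := G.exists_isTerminal hT
      exact ⟨E, fun _ => hE⟩
    · exact ⟨0, fun h => (hT h).elim⟩
  choose E hE using hex
  have hpos : ∀ᶠ T : ℝ in atTop, 0 < T := eventually_gt_atTop 0
  have hq : ∀ x, ∃ c, Tendsto (fun T => ⟪E T x, x⟫) atTop (𝓝 c) := fun x => by
    obtain ⟨p, hp⟩ := G.exists_transfer one_pos x
    -- Replacing T by `max 1 T` makes the family antitone on the whole line, and bounded below by
    -- means of the transfer to the origin in time one.
    have hanti : Antitone fun T : ℝ => ⟪E (max 1 T) x, x⟫ := fun T T' h =>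
      (hE (max 1 T) (by positivity)).antitone (by positivity) (max_le_max le_rfl h)
        (hE _ (by positivity)) x
    have hbdd : BddBelow (Set.range fun T : ℝ => ⟪E (max 1 T) x, x⟫) := by
      refine ⟨⟪p, x⟫, ?_⟩
      rintro _ ⟨T, rfl⟩
      exact (hE (max 1 T) (by positivity)).bound zero_le_one (le_max_left _ _) hp
    refine ⟨_, (tendsto_atTop_ciInf hanti hbdd).congr' ?_⟩
    filter_upwards [eventually_ge_atTop 1] with T hT
    rw [max_eq_right hT]
  obtain ⟨F, hF⟩ := exists_tendsto_of_quadratic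
    (hpos.mono fun T hT => (hE T hT).symm) hq
  have hsymm : ∀ x y, ⟪F x, y⟫ = ⟪x, F y⟫ := fun x y =>
    tendsto_nhds_unique_of_eventuallyEq ((hF x).inner tendsto_const_nhds)
      (tendsto_const_nhds.inner (hF y)) (hpos.mono fun T hT => (hE T hT).symm x y)
  have hneg : ∀ x, x ≠ 0 → ⟪F x, x⟫ < 0 := fun x hx =>
    lt_of_le_of_lt (le_of_tendsto ((hF x).inner tendsto_const_nhds) (by
      filter_upwards [eventually_ge_atTop 1] with T hT
      exact (hE 1 one_pos).antitone zero_le_one hT (hE T (by linarith)) x))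
      ((hE 1 one_pos).neg one_pos hx)
  have hinv : ∀ s x, (G.flow s (x, F x)).2 = F (G.flow s (x, F x)).1 := fun s x => by
    have h1 : Tendsto (fun T => G.flow s (x, E T x)) atTop (𝓝 (G.flow s (x, F x))) :=
      ((G.flow s).continuous.tendsto _).comp (tendsto_const_nhds.prodMk_nhds (hF x))
    have h2 : Tendsto (fun T : ℝ => T - s) atTop atTop := tendsto_atTop_add_const_right _ _ tendsto_id
    refine ext_inner_right ℝ fun y => ?_
    -- Both the operator `E (T - s)` and its argument vary with T. Symmetry moves the operator onto
    -- the fixed vector `y`, so that pointwise convergence is enough.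
    rw [hsymm]
    refine tendsto_nhds_unique_of_eventuallyEq
      (((continuous_snd.tendsto _).comp h1).inner tendsto_const_nhds)
      (((continuous_fst.tendsto _).comp h1).inner ((hF y).comp h2)) ?_
    filter_upwards [hpos, h2.eventually hpos] with T hT hTs
    simp only [Function.comp_apply]
    rw [(hE T hT).shift (hE _ hTs), (hE _ hTs).symm]
  refine ⟨LinearMap.toContinuousLinearMap F, ⟨hsymm, fun x => ?_⟩, hneg⟩
  have hsol := G.isSol_flow (x, F x) 0
  have h4 : (G.flow 0) = 1 := linFlow_zero _
  have hd := (LinearMap.toContinuousLinearMap F).hasFDerivAt.comp_hasDerivAt (0 : ℝ) hsol.1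
  -- Differentiating the invariance l = F x at time 0 in two ways gives the Riccati equation.
  have := hsol.2.unique (hd.congr_of_eventuallyEq (Eventually.of_forall fun s => hinv s x))
  simp only [h4, one_apply_eq_self, map_add, LinearMap.coe_toContinuousLinearMap'] at this ⊢
  rw [add_right_comm, ← this, sub_add_cancel]

/-- The Riccati equation has a positive definite solution. -/
theorem exists_isRiccati_pos :
    ∃ E : V →L[ℝ] V, G.IsRiccati E ∧ ∀ x, x ≠ 0 → 0 < ⟪E x, x⟫ := by
  -- Time reversal: changing A to -A keeps controllability and turns solutions of the Riccati
  -- equation into their negatives.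
  let G' : LQSystem V W :=
    { G with
      A := -G.A
      controllable := fun p hp => G.controllable p fun k => by
        have := hp k
        rw [map_neg, neg_pow] at this
        rcases neg_one_pow_eq_or (V →L[ℝ] V) k with h | h <;> simpa [h] using this }
  obtain ⟨E, hE, hneg⟩ := G'.exists_isRiccati_neg
  refine ⟨-E, ⟨fun x y => by simpa using hE.1 x y, fun x => ?_⟩, fun x hx => by
    simpa using hneg x hx⟩
  have h := hE.2 x
  have hA : G'.A = -G.A := rfl
  have hS : G'.S = G.S := rfl
  have hQ : G'.Q = G.Q := rfl
  rw [hA, hS, hQ] at h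
  rw [← h]
  simp

end LQSystem

end Riccati

/-! ### Two-point boundary value problems with uniform estimates -/

section Boundary

/-- A continuous path of units with a unit as its limit has bounded inverses. -/
lemma exists_bound_ringInverse {𝔸 : Type*} [NormedRing 𝔸] [HasSummableGeomSeries 𝔸] {Z : ℝ → 𝔸}
    {z : 𝔸} {T₀ : ℝ} (hc : Continuous Z) (hu : ∀ T, T₀ ≤ T → IsUnit (Z T))
    (hz : Tendsto Z atTop (𝓝 z)) (huz : IsUnit z) :
    ∃ C, ∀ T, T₀ ≤ T → ‖Ring.inverse (Z T)‖ ≤ C := by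
  have hcont : ∀ y : 𝔸, IsUnit y → ContinuousAt Ring.inverse y := by
    rintro _ ⟨y, rfl⟩
    exact NormedRing.inverse_continuousAt y
  have hlim : Tendsto (fun T => ‖Ring.inverse (Z T)‖) atTop (𝓝 ‖Ring.inverse z‖) :=
    ((hcont z huz).tendsto.comp hz).norm
  obtain ⟨T₁, hT₁⟩ := eventually_atTop.1
    (hlim.eventually (gt_mem_nhds (lt_add_one ‖Ring.inverse z‖)))
  have hon : ContinuousOn (fun T => Ring.inverse (Z T)) (Set.Icc T₀ T₁) := fun T hT =>
    ((hcont _ (hu T hT.1)).comp hc.continuousAt).continuousWithinAt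
  obtain ⟨C, hC⟩ := isCompact_Icc.exists_bound_of_continuousOn hon
  refine ⟨max C (‖Ring.inverse z‖ + 1), fun T hT => ?_⟩
  rcases le_total T T₁ with h | h
  · exact (hC T ⟨hT, h⟩).trans (le_max_left _ _)
  · exact (hT₁ T h).le.trans (le_max_right _ _)

/-- `M` generates a flow decaying at least like `exp (-c t)`. -/
def Decays {X : Type*} [NormedAddCommGroup X] [NormedSpace ℝ X] (M : X →L[ℝ] X) (c : ℝ) : Prop :=
  ∃ C, ∀ t, 0 ≤ t → ‖linFlow M t‖ ≤ C * Real.exp (-c * t)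

/-- The graphs of E and F are transverse: if v = -w then ⟪F w, w⟫ = ⟪E w, w⟫, against the signs
unless w = 0. -/
lemma eq_zero_of_stable_antistable {V : Type*} [NormedAddCommGroup V] [InnerProductSpace ℝ V]
    {E F : V →L[ℝ] V} (hneg : ∀ x, x ≠ 0 → ⟪E x, x⟫ < 0)
    (hpos : ∀ x, x ≠ 0 → 0 < ⟪F x, x⟫) {v w : V} (h1 : v + w = 0) (h2 : E v + F w = 0) :
    v = 0 ∧ w = 0 := by
  have hv : v = -w := eq_neg_of_add_eq_zero_left h1
  have hw : w = 0 := by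
    by_contra hw
    have h3 : ⟪E v + F w, w⟫ = 0 := by rw [h2, inner_zero_left]
    rw [hv, map_neg, inner_add_left, inner_neg_left] at h3
    linarith [hneg w hw, hpos w hw]
  exact ⟨by rw [hv, hw, neg_zero], hw⟩

section BoundaryMap

variable {V : Type*} [NormedAddCommGroup V] [NormedSpace ℝ V]

/-- The operator `(v, w) ↦ (v + q w, N₁ p v + N₂ w)`. -/
def boundaryMap (N₁ N₂ : V →L[ℝ] V) (pq : (V →L[ℝ] V) × (V →L[ℝ] V)) : V × V →L[ℝ] V × V :=
  ContinuousLinearMap.inl ℝ V V ∘L ContinuousLinearMap.fst ℝ V V +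
  ContinuousLinearMap.inl ℝ V V ∘L pq.2 ∘L ContinuousLinearMap.snd ℝ V V +
  ContinuousLinearMap.inr ℝ V V ∘L N₁ ∘L pq.1 ∘L ContinuousLinearMap.fst ℝ V V +
  ContinuousLinearMap.inr ℝ V V ∘L N₂ ∘L ContinuousLinearMap.snd ℝ V V

lemma boundaryMap_apply (N₁ N₂ : V →L[ℝ] V) (pq : (V →L[ℝ] V) × (V →L[ℝ] V)) (z : V × V) :
    boundaryMap N₁ N₂ pq z = (z.1 + pq.2 z.2, N₁ (pq.1 z.1) + N₂ z.2) := by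
  simp [boundaryMap]

lemma continuous_boundaryMap (N₁ N₂ : V →L[ℝ] V) : Continuous (boundaryMap N₁ N₂) := by
  unfold boundaryMap
  refine ((continuous_const.add ?_).add ?_).add continuous_const
  · exact continuous_const.clm_comp (continuous_snd.clm_comp continuous_const)
  · exact continuous_const.clm_comp
      (continuous_const.clm_comp (continuous_fst.clm_comp continuous_const))

end BoundaryMap

namespace LQSystem

variable {V W : Type*} [NormedAddCommGroup V] [InnerProductSpace ℝ V] [CompleteSpace V]
  [NormedAddCommGroup W] [InnerProductSpace ℝ W] [CompleteSpace W] (G : LQSystem V W)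

/-- The closed-loop operator `A + S E`. -/
def loop (E : V →L[ℝ] V) : V →L[ℝ] V := G.A + G.S ∘L E

lemma loop_apply (E : V →L[ℝ] V) (x : V) : G.loop E x = G.A x + G.S (E x) := rfl

variable {G}

lemma IsSol.add {x l y p : ℝ → V} (h : G.IsSol x l) (h' : G.IsSol y p) :
    G.IsSol (fun t => x t + y t) (fun t => l t + p t) := by
  refine fun t => ⟨((h t).1.add (h' t).1).congr_deriv ?_, ((h t).2.add (h' t).2).congr_deriv ?_⟩
    <;> simp only [map_add] <;> abel

lemma IsSol.comp_sub_const {x l : ℝ → V} (h : G.IsSol x l) (T : ℝ) :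
    G.IsSol (fun t => x (t - T)) (fun t => l (t - T)) :=
  fun t => ⟨(h (t - T)).1.comp_sub_const t T, (h (t - T)).2.comp_sub_const t T⟩

lemma IsRiccati.isSol {E : V →L[ℝ] V} (hE : G.IsRiccati E) (v : V) :
    G.IsSol (fun t => linFlow (G.loop E) t v) (fun t => E (linFlow (G.loop E) t v)) := by
  intro t
  have h := hasDerivAt_linFlow (G.loop E) v t
  refine ⟨h, (E.hasFDerivAt.comp_hasDerivAt t h).congr_deriv ?_⟩
  rw [← hE.2, loop_apply, map_add]
  abel

lemma IsRiccati.adjoint_loop {E : V →L[ℝ] V} (hE : G.IsRiccati E) (x : V) :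
    ((G.loop E)†) x = (G.A†) x + E (G.S x) := by
  refine ext_inner_right ℝ fun y => ?_
  rw [ContinuousLinearMap.adjoint_inner_left, loop_apply, inner_add_right, inner_add_left,
    ContinuousLinearMap.adjoint_inner_left, hE.1, G.S_symm]

/-- Subtracting the two Riccati equations shows that F - E intertwines A + S F with -(A + S E)*.
Hence one closed loop is antistable when the other is stable. -/
lemma IsRiccati.sub_apply_loop {E F : V →L[ℝ] V} (hE : G.IsRiccati E) (hF : G.IsRiccati F)
    (x : V) : (F - E) (G.loop F x) = -((G.loop E)†) ((F - E) x) := by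
  rw [hE.adjoint_loop, eq_neg_iff_add_eq_zero]
  have h1 := hE.2 x
  have h2 := hF.2 x
  simp only [loop_apply, sub_apply, map_add, map_sub]
  rw [← sub_eq_zero.2 (h2.trans h1.symm)]
  abel

/-- An injective operator is invertible. -/
lemma isUnit_of_injective {X : Type*} [NormedAddCommGroup X] [NormedSpace ℝ X] [CompleteSpace X]
    [FiniteDimensional ℝ X] {Z : X →L[ℝ] X} (h : ∀ x, Z x = 0 → x = 0) : IsUnit Z := by
  have hinj : Function.Injective Z := (injective_iff_map_eq_zero Z).2 h
  exact ContinuousLinearMap.isUnit_iff_bijective.2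
    ⟨hinj, (LinearMap.injective_iff_surjective (f := (Z : X →ₗ[ℝ] X))).1 hinj⟩

/-- The backward flow of the antistable closed loop is controlled by the forward flow of the
stable one. -/
lemma IsRiccati.exists_norm_linFlow_neg_le {E F : V →L[ℝ] V} (hE : G.IsRiccati E)
    (hF : G.IsRiccati F) (hD : IsUnit (F - E)) :
    ∃ C, ∀ t, ‖linFlow (G.loop F) (-t)‖ ≤ C * ‖linFlow (G.loop E) t‖ := by
  let _ : NormedAlgebra ℚ (V →L[ℝ] V) := NormedAlgebra.restrictScalars ℚ ℝ _
  obtain ⟨d, hd⟩ := hD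
  refine ⟨‖(↑d⁻¹ : V →L[ℝ] V)‖ * ‖(d : V →L[ℝ] V)‖, fun t => ?_⟩
  -- The exponential commutes with conjugation and with the adjoint, and the adjoint preserves the
  -- norm; only the conjugating factors enter the constant.
  have hconj : (-t) • G.loop F = ↑d⁻¹ * star (t • G.loop E) * ↑d := by
    rw [mul_assoc, ← Units.mul_right_inj d, Units.mul_inv_cancel_left, hd]
    ext x
    have := hE.sub_apply_loop hF x
    simp only [mul_apply_eq_comp, star_smul, star_trivial, smul_apply,
      map_smul, ContinuousLinearMap.star_eq_adjoint]
    rw [this, smul_neg, neg_smul, neg_neg]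
  rw [linFlow, hconj, NormedSpace.exp_units_conj', ← NormedSpace.star_exp]
  calc _ ≤ ‖(↑d⁻¹ : V →L[ℝ] V) * star (NormedSpace.exp (t • G.loop E))‖ * ‖(d : V →L[ℝ] V)‖ :=
        norm_mul_le _ _
    _ ≤ ‖(↑d⁻¹ : V →L[ℝ] V)‖ * ‖star (NormedSpace.exp (t • G.loop E))‖ * ‖(d : V →L[ℝ] V)‖ := by
        gcongr; exact norm_mul_le _ _
    _ = _ := by
        rw [ContinuousLinearMap.star_eq_adjoint, LinearIsometryEquiv.norm_map, linFlow]; ring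

variable (G)

/-- The boundary operator: it maps the initial stable component `v` and the final antistable
component `w` to the initial state and to the final value `N₁ v(T) + N₂ w`. -/
def boundary (E F N₁ N₂ : V →L[ℝ] V) (T : ℝ) : V × V →L[ℝ] V × V :=
  boundaryMap N₁ N₂ (linFlow (G.loop E) T, linFlow (G.loop F) (-T))

lemma boundary_apply (E F N₁ N₂ : V →L[ℝ] V) (T : ℝ) (z : V × V) :
    G.boundary E F N₁ N₂ T z =
      (z.1 + linFlow (G.loop F) (-T) z.2, N₁ (linFlow (G.loop E) T z.1) + N₂ z.2) :=
  boundaryMap_apply _ _ _ z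

lemma continuous_boundary (E F N₁ N₂ : V →L[ℝ] V) : Continuous (G.boundary E F N₁ N₂) :=
  (continuous_boundaryMap N₁ N₂).comp ((continuous_linFlow (G.loop E)).prodMk
    ((continuous_linFlow (G.loop F)).comp continuous_neg))

lemma tendsto_boundary {E F : V →L[ℝ] V} (N₁ N₂ : V →L[ℝ] V)
    (hE : Tendsto (linFlow (G.loop E)) atTop (𝓝 0))
    (hF : Tendsto (fun t => linFlow (G.loop F) (-t)) atTop (𝓝 0)) :
    Tendsto (G.boundary E F N₁ N₂) atTop (𝓝 (boundaryMap N₁ N₂ (0, 0))) :=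
  ((continuous_boundaryMap N₁ N₂).tendsto (0, 0)).comp (hE.prodMk_nhds hF)

variable {G}

variable [FiniteDimensional ℝ V]

/-- The two-point boundary value problem is uniquely solvable. -/
lemma isUnit_boundary {E F : V →L[ℝ] V} (hE : G.IsRiccati E) (hF : G.IsRiccati F)
    (hneg : ∀ x, x ≠ 0 → ⟪E x, x⟫ < 0) (hpos : ∀ x, x ≠ 0 → 0 < ⟪F x, x⟫)
    {N₁ N₂ : V →L[ℝ] V} (hN : ∀ v w, N₁ v + N₂ w = 0 → v + w = 0 ∨ E v + F w = 0)
    {T : ℝ} (hT : 0 < T) : IsUnit (G.boundary E F N₁ N₂ T) := by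
  refine isUnit_of_injective fun z hz => ?_
  rw [boundary_apply, Prod.mk_eq_zero] at hz
  have hsol := (hE.isSol z.1).add ((hF.isSol z.2).comp_sub_const T)
  -- The pairing vanishes at both ends: the state is zero at time 0, and `hN` makes the state or the
  -- costate zero at time T.
  have hzero := hsol.eq_zero (a := 0) (b := T) (by
    have h0 : linFlow (G.loop E) 0 z.1 + linFlow (G.loop F) (0 - T) z.2 = 0 := by
      simpa using hz.1
    rw [h0, inner_zero_right, sub_self, linFlow_zero, one_apply_eq_self]
    rcases hN _ _ hz.2 with h | h <;> simp [h]) (T / 2) ⟨by linarith, by linarith⟩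
  have := eq_zero_of_stable_antistable hneg hpos hzero.1 hzero.2
  exact Prod.ext (linFlow_injective (G.loop E) _ (by rw [this.1, Prod.fst_zero, map_zero]))
    (linFlow_injective (G.loop F) _ (by rw [this.2, Prod.snd_zero, map_zero]))

/-- Solutions of the two-point boundary value problems, with the turnpike estimate. -/
theorem exists_boundary_solution {E F : V →L[ℝ] V} (hE : G.IsRiccati E) (hF : G.IsRiccati F)
    (hneg : ∀ x, x ≠ 0 → ⟪E x, x⟫ < 0) (hpos : ∀ x, x ≠ 0 → 0 < ⟪F x, x⟫)
    {N₁ N₂ : V →L[ℝ] V} (hN : ∀ v w, N₁ v + N₂ w = 0 → v + w = 0 ∨ E v + F w = 0)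
    (hN₂ : ∀ w, N₂ w = 0 → w = 0) (a b : V) :
    ∃ X Y : ℝ → ℝ → V,
      (∀ T, 0 < T → G.IsSol (X T) (Y T) ∧ X T 0 = a ∧
        ∃ v w, X T T = v + w ∧ Y T T = E v + F w ∧ N₁ v + N₂ w = b) ∧
      ∀ c, 0 < c → Decays (G.loop E) c →
        ∀ T₀, (0 < T₀ ∨ (T₀ = 0 ∧ ∀ v w, v + w = 0 → N₁ v + N₂ w = 0 → v = 0 ∧ w = 0)) →
          ∃ C, ∀ T, 0 < T → T₀ ≤ T → ∀ t ∈ Set.Icc 0 T,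
            ‖X T t‖ + ‖Y T t‖ ≤ C * (Real.exp (-c * t) + Real.exp (-c * (T - t))) := by
  let z : ℝ → V × V := fun T => Ring.inverse (G.boundary E F N₁ N₂ T) (a, b)
  refine ⟨fun T t => linFlow (G.loop E) t (z T).1 + linFlow (G.loop F) (t - T) (z T).2,
    fun T t => E (linFlow (G.loop E) t (z T).1) + F (linFlow (G.loop F) (t - T) (z T).2),
    fun T hT => ?_, fun c hc hdec T₀ hT₀ => ?_⟩
  · have hz : G.boundary E F N₁ N₂ T (z T) = (a, b) := by
      rw [← mul_apply_eq_comp, Ring.mul_inverse_cancel _ (isUnit_boundary hE hF hneg hpos hN hT),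
        one_apply_eq_self]
    rw [boundary_apply, Prod.mk.injEq] at hz
    refine ⟨(hE.isSol _).add ((hF.isSol _).comp_sub_const T), by simpa using hz.1, _, _,
      rfl, rfl, by simpa using hz.2⟩
  · obtain ⟨C, hC⟩ := hdec
    have hD : IsUnit (F - E) := isUnit_of_injective fun x hx => by
      refine (eq_zero_of_stable_antistable hneg hpos (v := -x) (w := x) (by simp) ?_).2
      rw [map_neg, neg_add_eq_sub]; exact hx
    obtain ⟨C', hC'⟩ := hE.exists_norm_linFlow_neg_le hF hD
    have hexp : Tendsto (fun t => Real.exp (-c * t)) atTop (𝓝 0) :=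
      Real.tendsto_exp_atBot.comp (tendsto_id.const_mul_atTop_of_neg (by linarith))
    have hlimE : Tendsto (linFlow (G.loop E)) atTop (𝓝 0) := by
      refine squeeze_zero_norm' (a := fun t => C * Real.exp (-c * t)) ?_
        (by simpa using hexp.const_mul C)
      filter_upwards [eventually_ge_atTop 0] with t ht using hC t ht
    have hlimF : Tendsto (fun t => linFlow (G.loop F) (-t)) atTop (𝓝 0) :=
      squeeze_zero_norm (fun t => hC' t) (by simpa using hlimE.norm.const_mul C')
    -- A horizon T ≤ 0 occurs only when T₀ = 0; the boundary operator is then (v, w) ↦ (v + w, N₁ v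
    -- + N₂ w), whose injectivity is the extra assumption.
    have hunit : ∀ T, T₀ ≤ T → IsUnit (G.boundary E F N₁ N₂ T) := fun T hT => by
      by_cases hT' : 0 < T
      · exact isUnit_boundary hE hF hneg hpos hN hT'
      · obtain ⟨hT0, hN0⟩ := hT₀.resolve_left fun h => hT' (h.trans_le hT)
        have : T = 0 := by linarith [not_lt.1 hT']
        subst this
        refine isUnit_of_injective fun z hz => ?_
        rw [boundary_apply, Prod.mk_eq_zero] at hz
        have := hN0 z.1 z.2 (by simpa using hz.1) (by simpa using hz.2)
        exact Prod.ext this.1 this.2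
    -- As T → ∞ the two components decouple and the limit is (v, w) ↦ (v, N₂ w).
    obtain ⟨M, hM⟩ := exists_bound_ringInverse (G.continuous_boundary E F N₁ N₂) hunit
      (G.tendsto_boundary N₁ N₂ hlimE hlimF) (isUnit_of_injective fun z hz => by
        rw [boundaryMap_apply, Prod.mk_eq_zero] at hz
        simp only [zero_apply, map_zero, add_zero, zero_add] at hz
        exact Prod.ext hz.1 (hN₂ _ hz.2))
    have hC0 : 0 ≤ C := by simpa using (norm_nonneg _).trans (hC 0 le_rfl)
    refine ⟨(1 + ‖E‖) * (C * (M * ‖(a, b)‖)) + (1 + ‖F‖) * (|C'| * C * (M * ‖(a, b)‖)),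
      fun T hT hT₀ t ht => ?_⟩
    have hzn : ‖z T‖ ≤ M * ‖(a, b)‖ :=
      (ContinuousLinearMap.le_opNorm _ _).trans (by gcongr; exact hM T hT₀)
    have hM0 : 0 ≤ M * ‖(a, b)‖ := (norm_nonneg _).trans hzn
    have hv : ‖linFlow (G.loop E) t (z T).1‖ ≤ C * (M * ‖(a, b)‖) * Real.exp (-c * t) :=
      calc _ ≤ ‖linFlow (G.loop E) t‖ * ‖(z T).1‖ := ContinuousLinearMap.le_opNorm _ _
        _ ≤ (C * Real.exp (-c * t)) * (M * ‖(a, b)‖) := by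
          gcongr
          · exact hC t ht.1
          · exact (norm_fst_le _).trans hzn
        _ = _ := by ring
    have hw : ‖linFlow (G.loop F) (t - T) (z T).2‖
        ≤ |C'| * C * (M * ‖(a, b)‖) * Real.exp (-c * (T - t)) :=
      calc _ ≤ ‖linFlow (G.loop F) (t - T)‖ * ‖(z T).2‖ := ContinuousLinearMap.le_opNorm _ _
        _ ≤ (|C'| * (C * Real.exp (-c * (T - t)))) * (M * ‖(a, b)‖) := by
          gcongr
          · rw [← neg_sub T t]
            refine (hC' _).trans ?_
            gcongr
            · exact le_abs_self _
            · exact hC _ (by linarith [ht.2])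
          · exact (norm_snd_le _).trans hzn
        _ = _ := by ring
    set p := linFlow (G.loop E) t (z T).1
    set q := linFlow (G.loop F) (t - T) (z T).2
    have h1 : ‖p + q‖ + ‖E p + F q‖ ≤ (1 + ‖E‖) * ‖p‖ + (1 + ‖F‖) * ‖q‖ := by
      linarith [norm_add_le p q, norm_add_le (E p) (F q), E.le_opNorm p, F.le_opNorm q]
    refine h1.trans ?_
    have e1 := Real.exp_pos (-c * t)
    have e2 := Real.exp_pos (-c * (T - t))
    set α := C * (M * ‖(a, b)‖)
    have hα : 0 ≤ α := by positivity
    have hβ : 0 ≤ |C'| * C * (M * ‖(a, b)‖) := by positivity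
    set β := |C'| * C * (M * ‖(a, b)‖)
    calc _ ≤ (1 + ‖E‖) * (α * Real.exp (-c * t)) + (1 + ‖F‖) * (β * Real.exp (-c * (T - t))) := by
          gcongr
      _ ≤ (1 + ‖E‖) * (α * (Real.exp (-c * t) + Real.exp (-c * (T - t)))) +
          (1 + ‖F‖) * (β * (Real.exp (-c * t) + Real.exp (-c * (T - t)))) := by
          gcongr <;> linarith
      _ = _ := by ring

end LQSystem

end Boundary

/-! ### Exponential decay from eigenvalues -/

section Decay

variable {X : Type*} [NormedAddCommGroup X] [NormedSpace ℂ X] [CompleteSpace X]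

lemma exp_smul_one_add (L : X →L[ℂ] X) (μ t : ℂ) :
    NormedSpace.exp (t • L) = Complex.exp (t * μ) • NormedSpace.exp (t • (L - μ • 1)) := by
  let _ : NormedAlgebra ℚ (X →L[ℂ] X) := NormedAlgebra.restrictScalars ℚ ℂ _
  have h1 : t • L = algebraMap ℂ (X →L[ℂ] X) (t * μ) + t • (L - μ • 1) := by
    rw [Algebra.algebraMap_eq_smul_one, smul_sub, mul_smul]; abel
  rw [h1, NormedSpace.exp_add_of_commute (Algebra.commutes _ _),
    ← NormedSpace.algebraMap_exp_comm, ← Complex.exp_eq_exp_ℂ, Algebra.algebraMap_eq_smul_one,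
    smul_mul_assoc, one_mul]

lemma exp_apply_of_pow_apply_eq_zero (N : X →L[ℂ] X) {k : ℕ} {v : X} (hv : (N ^ k) v = 0)
    (t : ℂ) : NormedSpace.exp (t • N) v =
      ∑ j ∈ Finset.range k, ((j.factorial : ℂ)⁻¹ * t ^ j) • (N ^ j) v := by
  have h1 := (NormedSpace.exp_series_hasSum_exp' (𝕂 := ℂ) (t • N)).mapL
    (ContinuousLinearMap.apply ℂ X v)
  refine h1.unique ?_
  have h2 : ∀ j, (ContinuousLinearMap.apply ℂ X v) ((j.factorial : ℂ)⁻¹ • (t • N) ^ j) =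
      ((j.factorial : ℂ)⁻¹ * t ^ j) • (N ^ j) v := fun j => by
    simp [smul_pow, mul_smul]
  simp only [h2]
  refine hasSum_sum_of_ne_finset_zero fun j hj => ?_
  obtain ⟨i, rfl⟩ := Nat.exists_eq_add_of_le' (not_lt.1 (Finset.mem_range.not.1 hj))
  rw [pow_add N, mul_apply_eq_comp, hv, map_zero, smul_zero]

/-- On a generalized eigenvector the exponential is exp(t μ) times a polynomial in t. A spectral gap
absorbs the polynomial; without a gap it has to be constant, so a genuine eigenvector is required.
-/
lemma exists_bound_exp_apply (L : X →L[ℂ] X) {μ : ℂ} {c : ℝ} {k : ℕ} {v : X}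
    (hv : ((L - μ • 1) ^ k) v = 0)
    (h : μ.re < -c ∨ (μ.re = -c ∧ (L - μ • 1) v = 0)) :
    ∃ C, ∀ t : ℝ, 0 ≤ t → ‖NormedSpace.exp ((t : ℂ) • L) v‖ ≤ C * Real.exp (-c * t) := by
  rcases h with h | ⟨h, hv'⟩
  · set δ := -c - μ.re with hδ
    have hδ0 : 0 < δ := by linarith
    refine ⟨∑ j ∈ Finset.range k, (δ ^ j)⁻¹ * ‖((L - μ • 1) ^ j) v‖, fun t ht => ?_⟩
    rw [exp_smul_one_add L μ, smul_apply, exp_apply_of_pow_apply_eq_zero _ hv, norm_smul,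
      Complex.norm_exp]
    have hre : ((t : ℂ) * μ).re = t * μ.re := by simp
    have hsum : ‖∑ j ∈ Finset.range k, ((j.factorial : ℂ)⁻¹ * (t : ℂ) ^ j) •
        ((L - μ • 1) ^ j) v‖ ≤
        (∑ j ∈ Finset.range k, (δ ^ j)⁻¹ * ‖((L - μ • 1) ^ j) v‖) * Real.exp (δ * t) := by
      rw [Finset.sum_mul]
      refine norm_sum_le_of_le _ fun j _ => ?_
      rw [norm_smul, norm_mul, norm_inv, norm_pow, Complex.norm_natCast, Complex.norm_real,
        Real.norm_of_nonneg ht, mul_right_comm (δ ^ j)⁻¹]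
      refine mul_le_mul_of_nonneg_right ?_ (norm_nonneg _)
      -- One term of the series of exp(δ t) bounds the monomial of degree j at the price of δ⁻ʲ.
      have := Real.pow_div_factorial_le_exp (δ * t) (by positivity) j
      rw [mul_pow] at this
      rw [inv_mul_eq_div, inv_mul_eq_div, le_div_iff₀ (by positivity)]
      calc _ = δ ^ j * t ^ j / j.factorial := by ring
        _ ≤ _ := this
    calc _ ≤ Real.exp (t * μ.re) * ((∑ j ∈ Finset.range k, (δ ^ j)⁻¹ *
          ‖((L - μ • 1) ^ j) v‖) * Real.exp (δ * t)) := by rw [hre]; gcongr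
      _ = (∑ j ∈ Finset.range k, (δ ^ j)⁻¹ * ‖((L - μ • 1) ^ j) v‖) *
          Real.exp (t * μ.re + δ * t) := by rw [Real.exp_add]; ring
      _ = _ := by rw [hδ]; ring_nf
  · refine ⟨‖v‖, fun t ht => ?_⟩
    rw [exp_smul_one_add L μ, smul_apply,
      exp_apply_of_pow_apply_eq_zero (k := 1) _ (by simpa using hv'), norm_smul, Complex.norm_exp]
    simp [h, mul_comm]

/-- Decay of the exponential of an operator whose eigenvalues have real part at most `-c`, those
of real part `-c` being semisimple. -/
lemma exists_bound_exp [FiniteDimensional ℂ X] (L : X →L[ℂ] X) {c : ℝ}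
    (h : ∀ μ : ℂ, (∃ v, v ≠ 0 ∧ L v = μ • v) → μ.re < -c ∨
      (μ.re = -c ∧ ∀ v, (L - μ • 1) ((L - μ • 1) v) = 0 → (L - μ • 1) v = 0)) :
    ∃ C, ∀ t : ℝ, 0 ≤ t → ‖NormedSpace.exp ((t : ℂ) • L)‖ ≤ C * Real.exp (-c * t) := by
  -- The vectors with the desired decay form a subspace; it is everything as soon as it contains the
  -- generalized eigenspaces, which span over ℂ.
  let P : Submodule ℂ X :=
    { carrier := {v | ∃ C, ∀ t : ℝ, 0 ≤ t →
        ‖NormedSpace.exp ((t : ℂ) • L) v‖ ≤ C * Real.exp (-c * t)}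
      zero_mem' := ⟨0, by simp⟩
      add_mem' := by
        rintro v w ⟨C, hC⟩ ⟨D, hD⟩
        refine ⟨C + D, fun t ht => ?_⟩
        rw [map_add, add_mul]
        exact (norm_add_le _ _).trans (add_le_add (hC t ht) (hD t ht))
      smul_mem' := by
        rintro a v ⟨C, hC⟩
        refine ⟨‖a‖ * C, fun t ht => ?_⟩
        rw [map_smul, norm_smul, mul_assoc]
        gcongr
        exact hC t ht }
  have htop : (⊤ : Submodule ℂ X) ≤ P := by
    rw [← Module.End.iSup_maxGenEigenspace_eq_top (L : X →ₗ[ℂ] X)]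
    refine iSup_le fun μ v hv => ?_
    obtain ⟨k, hk⟩ := (Module.End.mem_maxGenEigenspace _ _ _).1 hv
    have hpow : ∀ (j : ℕ) (w : X), (((L : X →ₗ[ℂ] X) - μ • 1) ^ j) w = ((L - μ • 1) ^ j) w := by
      intro j
      induction j with
      | zero => intro w; rfl
      | succ j ih => intro w; rw [pow_succ, pow_succ, Module.End.mul_apply, ih]; rfl
    rw [hpow] at hk
    -- If μ is not an eigenvalue, the hypothesis says nothing about it, but its generalized
    -- eigenspace is trivial.
    by_cases hinj : ∀ w, (L - μ • 1) w = 0 → w = 0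
    · have : ∀ j : ℕ, ∀ w, ((L - μ • 1) ^ j) w = 0 → w = 0 := by
        intro j
        induction j with
        | zero => intro w hw; exact hw
        | succ j ih =>
          intro w hw
          rw [pow_succ, mul_apply_eq_comp] at hw
          exact hinj _ (ih _ hw)
      rw [this k v hk]
      exact P.zero_mem
    · push Not at hinj
      obtain ⟨w, hw, hw0⟩ := hinj
      refine exists_bound_exp_apply L hk ((h μ ⟨w, hw0, ?_⟩).imp_right fun h' => ⟨h'.1, ?_⟩)
      · simpa [sub_eq_zero] using hw
      -- Semisimplicity only says that the kernel of the square equals the kernel; induction extends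
      -- this to all powers.
      · have : ∀ j : ℕ, ∀ w, ((L - μ • 1) ^ (j + 1)) w = 0 → (L - μ • 1) w = 0 := by
          intro j
          induction j with
          | zero => intro w hw; simpa using hw
          | succ j ih =>
            intro w hw
            rw [pow_succ, mul_apply_eq_comp] at hw
            exact h'.2 _ (ih _ hw)
        rcases k with _ | k
        · have : v = 0 := hk
          rw [this, map_zero]
        · exact this k v hk
  -- Uniform boundedness of the rescaled family exp(c t) exp(t L) turns the estimates for each
  -- vector into an operator norm estimate.
  obtain ⟨C, hC⟩ := banach_steinhaus
    (g := fun t : {t : ℝ // 0 ≤ t} => (Real.exp (c * t) : ℂ) • NormedSpace.exp ((t : ℂ) • L))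
    fun v => by
      obtain ⟨C, hC⟩ := htop (Submodule.mem_top (x := v))
      refine ⟨C, fun t => ?_⟩
      rw [smul_apply, norm_smul, Complex.norm_real, Real.norm_of_nonneg (Real.exp_pos _).le]
      calc _ ≤ Real.exp (c * t) * (C * Real.exp (-c * t)) := by gcongr; exact hC t t.2
        _ = C * Real.exp (c * t + -c * t) := by rw [Real.exp_add]; ring
        _ = C := by simp
  refine ⟨C, fun t ht => ?_⟩
  have := hC ⟨t, ht⟩
  rw [norm_smul, Complex.norm_real, Real.norm_of_nonneg (Real.exp_pos _).le] at this
  rw [neg_mul, Real.exp_neg, ← div_eq_mul_inv, le_div_iff₀ (Real.exp_pos _), mul_comm]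
  exact this

end Decay

/-! ### Real matrices and their complexification -/

section MatrixDecay

variable {n : ℕ}

attribute [local instance] Matrix.linftyOpNormedRing Matrix.linftyOpNormedAlgebra

/-- A real matrix as an operator on `ℝⁿ`. -/
abbrev op (M : Matrix (Fin n) (Fin n) ℝ) : Vec n →L[ℝ] Vec n :=
  Matrix.toEuclideanCLM (n := Fin n) (𝕜 := ℝ) M

/-- A real matrix as an operator on `ℂⁿ`. -/
def cop : Matrix (Fin n) (Fin n) ℝ →+* (EuclideanSpace ℂ (Fin n) →L[ℂ] EuclideanSpace ℂ (Fin n)) :=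
  (Matrix.toEuclideanCLM (n := Fin n) (𝕜 := ℂ) : _ →+* _).comp Complex.ofRealHom.mapMatrix

lemma cop_apply (M : Matrix (Fin n) (Fin n) ℝ) :
    cop M = Matrix.toEuclideanCLM (n := Fin n) (𝕜 := ℂ) (M.map Complex.ofReal) := rfl

lemma continuous_cop : Continuous (cop (n := n)) := by
  have h1 : Continuous fun M : Matrix (Fin n) (Fin n) ℝ => M.map Complex.ofReal :=
    continuous_id.matrix_map Complex.continuous_ofReal
  have h2 : Continuous (Matrix.toEuclideanCLM (n := Fin n) (𝕜 := ℂ)) :=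
    LinearMap.continuous_of_finiteDimensional
      ((Matrix.toEuclideanCLM (n := Fin n) (𝕜 := ℂ)).toAlgEquiv.toLinearMap)
  exact h2.comp h1

/-- The inclusion of ℝⁿ in ℂⁿ is isometric and intertwines the two operators, so decay proved over ℂ
passes to the real flow. -/
lemma norm_op_le (M : Matrix (Fin n) (Fin n) ℝ) : ‖op M‖ ≤ ‖cop M‖ := by
  let J : Vec n → EuclideanSpace ℂ (Fin n) := fun v => WithLp.toLp 2 fun i => (v i : ℂ)
  have hJ : ∀ v, ‖J v‖ = ‖v‖ := fun v => by simp [J, EuclideanSpace.norm_eq]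
  refine ContinuousLinearMap.opNorm_le_bound _ (norm_nonneg _) fun v => ?_
  have : J (op M v) = cop M (J v) := by
    ext i
    simp [J, op, cop_apply, Matrix.mulVec, dotProduct]
  rw [← hJ, this, ← hJ v]
  exact ContinuousLinearMap.le_opNorm _ _

lemma norm_linFlow_op_le (M : Matrix (Fin n) (Fin n) ℝ) (t : ℝ) :
    ‖linFlow (op M) t‖ ≤ ‖NormedSpace.exp ((t : ℂ) • cop M)‖ := by
  let _ : NormedAlgebra ℚ (Matrix (Fin n) (Fin n) ℝ) := NormedAlgebra.restrictScalars ℚ ℝ _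
  let _ : NormedAlgebra ℚ (EuclideanSpace ℂ (Fin n) →L[ℂ] EuclideanSpace ℂ (Fin n)) :=
    NormedAlgebra.restrictScalars ℚ ℂ _
  let _ : NormedAlgebra ℚ (Vec n →L[ℝ] Vec n) := NormedAlgebra.restrictScalars ℚ ℝ _
  have h2 : Continuous (Matrix.toEuclideanCLM (n := Fin n) (𝕜 := ℝ)) :=
    LinearMap.continuous_of_finiteDimensional
      ((Matrix.toEuclideanCLM (n := Fin n) (𝕜 := ℝ)).toAlgEquiv.toLinearMap)
  have e1 := NormedSpace.map_exp _ h2 (t • M)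
  have e2 := NormedSpace.map_exp _ continuous_cop (t • M)
  have h3 : t • op M = op (t • M) := (map_smul _ _ _).symm
  have h4 : (t : ℂ) • cop M = cop (t • M) := by
    ext v i
    simp [cop_apply, Matrix.mulVec, dotProduct, Finset.mul_sum, mul_assoc]
  rw [linFlow, h3, h4, ← e2, ← e1]
  exact norm_op_le _

lemma mem_spectrum_of_cop {M : Matrix (Fin n) (Fin n) ℝ} {μ : ℂ} :
    μ ∈ spectrum ℂ (M.map Complex.ofReal) ↔ ∃ v, v ≠ 0 ∧ cop M v = μ • v := by
  rw [← AlgEquiv.spectrum_eq (Matrix.toEuclideanCLM (n := Fin n) (𝕜 := ℂ)), ← cop_apply,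
    ContinuousLinearMap.spectrum_eq, ← Module.End.hasEigenvalue_iff_mem_spectrum]
  constructor
  · intro h
    obtain ⟨v, hv⟩ := h.exists_hasEigenvector
    exact ⟨v, hv.2, hv.apply_eq_smul⟩
  · rintro ⟨v, hv, h⟩
    exact Module.End.hasEigenvalue_of_hasEigenvector ⟨Module.End.mem_eigenspace_iff.2 h, hv⟩

lemma cop_sub_smul_apply (M : Matrix (Fin n) (Fin n) ℝ) (μ : ℂ) (v : EuclideanSpace ℂ (Fin n)) :
    ((cop M - μ • 1) v).ofLp =
      (M.map Complex.ofReal - Matrix.scalar (Fin n) μ).mulVec v.ofLp := by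
  rw [Matrix.sub_mulVec]
  simp [cop_apply, ← Matrix.smul_one_eq_diagonal, Matrix.smul_mulVec]

/-- Decay of the flow of a real matrix, read off from its complex spectrum. -/
theorem decays_op {M : Matrix (Fin n) (Fin n) ℝ} {c : ℝ}
    (h : ∀ μ ∈ spectrum ℂ (M.map Complex.ofReal), μ.re < -c ∨
      (μ.re = -c ∧ IsSemisimpleAt (M.map Complex.ofReal) μ)) : Decays (op M) c := by
  obtain ⟨C, hC⟩ := exists_bound_exp (cop M) (c := c) fun μ hμ =>
    (h μ (mem_spectrum_of_cop.2 hμ)).imp_right fun h' => ⟨h'.1, fun v hv => by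
      have h1 := h'.2 v.ofLp (by
        rw [pow_two, ← Matrix.mulVec_mulVec, ← cop_sub_smul_apply, ← cop_sub_smul_apply, hv]
        rfl)
      rw [← cop_sub_smul_apply] at h1
      exact (WithLp.ofLp_injective 2) h1⟩
  exact ⟨C, fun t ht => (norm_linFlow_op_le M t).trans (hC t ht)⟩

end MatrixDecay

/-! ### Stability and minimality of the negative definite solution -/

section Stability

namespace LQSystem

variable {V W : Type*} [NormedAddCommGroup V] [InnerProductSpace ℝ V] [CompleteSpace V]
  [NormedAddCommGroup W] [InnerProductSpace ℝ W] [CompleteSpace W] {G : LQSystem V W}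

/-- The Lyapunov identity of a Riccati solution. -/
lemma IsRiccati.two_mul_inner_loop {E : V →L[ℝ] V} (hE : G.IsRiccati E) (x : V) :
    2 * ⟪E x, G.loop E x⟫ = ⟪G.Q x, x⟫ + ⟪G.S (E x), E x⟫ := by
  rw [← hE.2 x, loop_apply, inner_add_left, inner_add_left, inner_add_right, hE.1 (G.A x),
    hE.1 (G.S (E x)), ContinuousLinearMap.adjoint_inner_left, real_inner_comm (E x) (G.A x),
    real_inner_comm (E x) (G.S (E x))]
  ring

/-- An eigenvalue `α + i β` of the closed loop, with eigenvector `a + i b`, has negative real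
part. -/
lemma IsRiccati.re_neg {E : V →L[ℝ] V} (hE : G.IsRiccati E)
    (hneg : ∀ x, x ≠ 0 → ⟪E x, x⟫ < 0) {a b : V} {α β : ℝ} (hab : a ≠ 0 ∨ b ≠ 0)
    (ha : G.loop E a = α • a - β • b) (hb : G.loop E b = β • a + α • b) : α < 0 := by
  have h1 := hE.two_mul_inner_loop a
  have h2 := hE.two_mul_inner_loop b
  rw [ha, inner_sub_right, inner_smul_right, inner_smul_right] at h1
  rw [hb, inner_add_right, inner_smul_right, inner_smul_right, hE.1 b a, real_inner_comm] at h2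
  have hn : ∀ x, ⟪E x, x⟫ ≤ 0 := fun x => by
    rcases eq_or_ne x 0 with rfl | h
    · simp
    · exact (hneg x h).le
  have hsum : 0 < ⟪G.Q a, a⟫ + ⟪G.Q b, b⟫ := by
    rcases hab with h | h
    · linarith [G.Q_pos _ h, G.Q_nonneg b]
    · linarith [G.Q_pos _ h, G.Q_nonneg a]
  -- In the sum of the two Lyapunov identities the terms in β cancel by symmetry of E.
  have h3 : 0 < α * (⟪E a, a⟫ + ⟪E b, b⟫) := by
    linarith [G.S_nonneg (E a), G.S_nonneg (E b)]
  by_contra! hα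
  nlinarith [hn a, hn b]

/-- A Riccati solution with stable closed loop is minimal. -/
lemma IsRiccati.inner_sub_nonneg {E F : V →L[ℝ] V} (hE : G.IsRiccati E) (hF : G.IsRiccati F)
    {c : ℝ} (hc : 0 < c) (hdec : Decays (G.loop E) c) (x : V) : 0 ≤ ⟪(F - E) x, x⟫ := by
  set D := F - E with hD
  set y : ℝ → V := fun t => linFlow (G.loop E) t x with hy
  have hDs : ∀ u v, ⟪D u, v⟫ = ⟪u, D v⟫ := fun u v => by
    simp only [hD, sub_apply, inner_sub_left, inner_sub_right, hE.1, hF.1]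
  -- Along the stable closed loop the form of F - E is nonincreasing and tends to 0, hence it is
  -- nonnegative at the start.
  have hder : ∀ t, HasDerivAt (fun t => ⟪D (y t), y t⟫) (-⟪G.S (D (y t)), D (y t)⟫) t := fun t => by
    have h := hasDerivAt_linFlow (G.loop E) x t
    refine ((D.hasFDerivAt.comp_hasDerivAt t h).inner ℝ h).congr_deriv ?_
    have h1 : G.loop F (y t) = G.loop E (y t) + G.S (D (y t)) := by
      simp only [loop_apply, hD, sub_apply, map_sub]; abel
    have h2 : ⟪D (G.loop F (y t)), y t⟫ = -⟪D (y t), G.loop E (y t)⟫ := by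
      rw [hE.sub_apply_loop hF, inner_neg_left, ContinuousLinearMap.adjoint_inner_left]
    rw [h1, map_add, inner_add_left, hDs (G.S _)] at h2
    simp only [Function.comp_apply]
    change ⟪D (y t), G.loop E (y t)⟫ + ⟪D (G.loop E (y t)), y t⟫ = _
    linarith
  have hanti : Antitone fun t => ⟪D (y t), y t⟫ :=
    antitone_of_hasDerivAt_nonpos hder fun t => by simpa using G.S_nonneg (D (y t))
  obtain ⟨C, hC⟩ := hdec
  have hexp : Tendsto (fun t => Real.exp (-c * t)) atTop (𝓝 0) :=
    Real.tendsto_exp_atBot.comp (tendsto_id.const_mul_atTop_of_neg (by linarith))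
  have hy0 : Tendsto y atTop (𝓝 0) := by
    refine squeeze_zero_norm' (a := fun t => C * Real.exp (-c * t) * ‖x‖) ?_
      (by simpa using (hexp.const_mul C).mul_const ‖x‖)
    filter_upwards [eventually_ge_atTop 0] with t ht
    exact (ContinuousLinearMap.le_opNorm _ _).trans (by gcongr; exact hC t ht)
  have hlim : Tendsto (fun t => ⟪D (y t), y t⟫) atTop (𝓝 0) := by
    simpa using ((D.continuous.tendsto 0).comp hy0).inner (𝕜 := ℝ) hy0
  have := hanti.le_of_tendsto hlim 0
  simpa [hy] using this

end LQSystem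

end Stability

/-! ### From matrices to operators, and the Kalman condition -/

section Matrices

variable {k l n m : ℕ}

/-- The product with a matrix as a continuous linear map. -/
def actL (M : Matrix (Fin k) (Fin l) ℝ) : Vec l →L[ℝ] Vec k :=
  LinearMap.toContinuousLinearMap (Matrix.toEuclideanLin M)

lemma act_eq_actL (M : Matrix (Fin k) (Fin l) ℝ) (v : Vec l) : act M v = actL M v := rfl

lemma act_eq_op (M : Matrix (Fin n) (Fin n) ℝ) (v : Vec n) : act M v = op M v := rfl

lemma act_act {j : ℕ} (M : Matrix (Fin j) (Fin k) ℝ) (N : Matrix (Fin k) (Fin l) ℝ) (v : Vec l) :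
    act M (act N v) = act (M * N) v := by
  simp [act]

lemma inner_act (M : Matrix (Fin k) (Fin l) ℝ) (x : Vec l) (y : Vec k) :
    ⟪act M x, y⟫ = ⟪x, act M.transpose y⟫ := by
  simp only [EuclideanSpace.inner_eq_star_dotProduct, act, star_trivial]
  rw [Matrix.dotProduct_mulVec, Matrix.mulVec_transpose]

lemma adjoint_actL (M : Matrix (Fin k) (Fin l) ℝ) (y : Vec k) :
    ((actL M)†) y = act M.transpose y := by
  refine ext_inner_left ℝ fun x => ?_
  rw [ContinuousLinearMap.adjoint_inner_right, ← inner_act]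
  rfl

lemma adjoint_op (M : Matrix (Fin n) (Fin n) ℝ) (y : Vec n) :
    ((op M)†) y = act M.transpose y := adjoint_actL M y

lemma inner_act_symm {M : Matrix (Fin n) (Fin n) ℝ} (hM : M.PosDef) (x y : Vec n) :
    ⟪act M x, y⟫ = ⟪x, act M y⟫ := by
  have : M.transpose = M := by simpa [Matrix.IsHermitian] using hM.isHermitian
  rw [inner_act, this]

lemma inner_act_pos {M : Matrix (Fin n) (Fin n) ℝ} (hM : M.PosDef) {x : Vec n} (hx : x ≠ 0) :
    0 < ⟪act M x, x⟫ := by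
  have := hM.dotProduct_mulVec_pos (x := x.ofLp) (by simpa using hx)
  simpa [EuclideanSpace.inner_eq_star_dotProduct, act] using this

lemma inner_act_nonneg {M : Matrix (Fin n) (Fin n) ℝ} (hM : M.PosDef) (x : Vec n) :
    0 ≤ ⟪act M x, x⟫ := by
  rcases eq_or_ne x 0 with rfl | h
  · simp
  · exact (inner_act_pos hM h).le

/-- By rank–nullity the transpose of the Kalman matrix is injective; its rows use only the exponents
below n. -/
lemma Kalman.eq_zero {A : Matrix (Fin n) (Fin n) ℝ} {B : Matrix (Fin n) (Fin m) ℝ}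
    (h : Kalman A B) {p : Fin n → ℝ}
    (hp : ∀ k : ℕ, (B.transpose * A.transpose ^ k).mulVec p = 0) : p = 0 := by
  have hr : (kalmanMatrix A B).transpose.rank = n := by rw [Matrix.rank_transpose]; exact h
  have hk := LinearMap.finrank_range_add_finrank_ker (kalmanMatrix A B).transpose.mulVecLin
  rw [← Matrix.rank, hr, Module.finrank_fin_fun, Nat.add_eq_left, Submodule.finrank_eq_zero] at hk
  refine LinearMap.ker_eq_bot'.1 hk p ?_
  ext ⟨k, j⟩
  have := congrFun (hp k) j
  rw [← Matrix.transpose_pow, ← Matrix.transpose_mul] at this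
  exact this

/-- The homogeneous system attached to the data. -/
def Data.system (P : Data n m) (hQ : P.Q.PosDef) (hU : P.U.PosDef) (hK : Kalman P.A P.B) :
    LQSystem (Vec n) (Vec m) where
  A := op P.A
  B := actL P.B
  Q := op P.Q
  R := op P.U⁻¹
  Q_symm := inner_act_symm hQ
  Q_pos _ hx := inner_act_pos hQ hx
  R_symm := inner_act_symm hU.inv
  R_pos _ hx := inner_act_pos hU.inv hx
  controllable p hp := by
    have h : ∀ (k : ℕ) (p : Vec n), (((op P.A)†) ^ k) p = act (P.A.transpose ^ k) p := by
      intro k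
      induction k with
      | zero => intro p; simp [act]
      | succ k ih =>
        intro p
        rw [pow_succ, mul_apply_eq_comp, ih, adjoint_op, act_act, pow_succ]
    refine (WithLp.ofLp_injective 2) (hK.eq_zero (p := p.ofLp) fun k => ?_)
    have := hp k
    rw [h, adjoint_actL, act_act] at this
    exact congrArg WithLp.ofLp this

end Matrices

/-! ### Gradients of linear and quadratic terms and of the Hamiltonian -/

section Gradient

variable {X Y : Type*} [NormedAddCommGroup X] [InnerProductSpace ℝ X] [CompleteSpace X]
  [NormedAddCommGroup Y] [InnerProductSpace ℝ Y] [CompleteSpace Y]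

lemma hasFDerivAt_inner_clm (p : Y) (L : X →L[ℝ] Y) (x : X) :
    HasFDerivAt (fun y => ⟪p, L y⟫) (InnerProductSpace.toDual ℝ X ((L†) p)) x := by
  have : InnerProductSpace.toDual ℝ X ((L†) p) = (innerSL ℝ p) ∘L L := by
    ext y; simp [ContinuousLinearMap.adjoint_inner_left]
  rw [this]
  exact ((innerSL ℝ p) ∘L L).hasFDerivAt

lemma hasFDerivAt_quadratic {M : X →L[ℝ] X} (hM : ∀ x y, ⟪M x, y⟫ = ⟪x, M y⟫) (a x : X) :
    HasFDerivAt (fun y => 1 / 2 * ⟪y - a, M (y - a)⟫)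
      (InnerProductSpace.toDual ℝ X (M (x - a))) x := by
  have h1 : HasFDerivAt (fun y : X => y - a) (ContinuousLinearMap.id ℝ X) x :=
    (hasFDerivAt_id x).sub_const a
  have h2 := (h1.inner ℝ (M.hasFDerivAt.comp x h1)).const_mul (1 / 2)
  refine h2.congr_fderiv ?_
  ext y
  change 1 / 2 * (⟪x - a, M y⟫ + ⟪y, M (x - a)⟫) = ⟪M (x - a), y⟫
  rw [← hM, real_inner_comm y]
  ring

end Gradient

section Gradients

variable {n m : ℕ} (P : Data n m)

lemma Data.gradient_H_costate (x l : Vec n) (u : Vec m) :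
    gradient (fun p => P.H x p (-1) u) l = P.f x u := by
  refine HasGradientAt.gradient (f' := P.f x u) ?_
  have h := (hasFDerivAt_inner_clm (P.f x u) (ContinuousLinearMap.id ℝ (Vec n)) l).add_const
    (-1 * P.f0 x u)
  rw [ContinuousLinearMap.adjoint_id] at h
  refine HasFDerivAt.congr_of_eventuallyEq h (Eventually.of_forall fun p => ?_)
  simp [Data.H, real_inner_comm]

lemma Data.gradient_H_state (hQ : P.Q.PosDef) (x l : Vec n) (u : Vec m) :
    gradient (fun y => P.H y l (-1) u) x = act P.A.transpose l - act P.Q (x - P.xd) := by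
  refine HasGradientAt.gradient (f' := act P.A.transpose l - act P.Q (x - P.xd)) ?_
  have h := ((hasFDerivAt_inner_clm l (actL P.A) x).sub
    (hasFDerivAt_quadratic (M := op P.Q) (inner_act_symm hQ) P.xd x)).add_const
    (⟪l, act P.B u⟫ - 1 / 2 * ⟪u - P.ud, act P.U (u - P.ud)⟫)
  rw [adjoint_actL, ← map_sub] at h
  refine HasFDerivAt.congr_of_eventuallyEq h (Eventually.of_forall fun p => ?_)
  simp only [Data.H, Data.f, Data.f0, inner_add_right, act_eq_actL, Pi.sub_apply]
  change _ = _ - 1 / 2 * ⟪p - P.xd, actL P.Q (p - P.xd)⟫ + _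
  ring

lemma Data.gradient_H_control (hU : P.U.PosDef) (x l : Vec n) (u : Vec m) :
    gradient (fun v => P.H x l (-1) v) u = act P.B.transpose l - act P.U (u - P.ud) := by
  refine HasGradientAt.gradient (f' := act P.B.transpose l - act P.U (u - P.ud)) ?_
  have h := ((hasFDerivAt_inner_clm l (actL P.B) u).sub
    (hasFDerivAt_quadratic (M := op P.U) (inner_act_symm hU) P.ud u)).add_const
    (⟪l, act P.A x⟫ - 1 / 2 * ⟪x - P.xd, act P.Q (x - P.xd)⟫)
  rw [adjoint_actL, ← map_sub] at h
  refine HasFDerivAt.congr_of_eventuallyEq h (Eventually.of_forall fun p => ?_)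
  simp only [Data.H, Data.f, Data.f0, inner_add_right, act_eq_actL, Pi.sub_apply]
  change _ = _ - 1 / 2 * ⟪p - P.ud, actL P.U (p - P.ud)⟫ + _
  ring

end Gradients

/-! ### The static problem -/

section Static

variable {n m : ℕ} (P : Data n m)

/-- The quadratic part of the running cost. -/
def Data.quad (d : Vec n) (e : Vec m) : ℝ :=
  1 / 2 * ⟪act P.Q d, d⟫ + 1 / 2 * ⟪act P.U e, e⟫

variable {P}

lemma Data.quad_nonneg (hQ : P.Q.PosDef) (hU : P.U.PosDef) (d : Vec n) (e : Vec m) :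
    0 ≤ P.quad d e := by
  have := inner_act_nonneg hQ d
  have := inner_act_nonneg hU e
  unfold Data.quad
  positivity

lemma Data.eq_zero_of_quad (hQ : P.Q.PosDef) (hU : P.U.PosDef) {d : Vec n} {e : Vec m}
    (h : P.quad d e = 0) : d = 0 ∧ e = 0 := by
  have h1 := inner_act_nonneg hQ d
  have h2 := inner_act_nonneg hU e
  unfold Data.quad at h
  constructor
  · by_contra hd
    linarith [inner_act_pos hQ hd]
  · by_contra he
    linarith [inner_act_pos hU he]

lemma inner_act_add {M : Matrix (Fin n) (Fin n) ℝ} (hM : M.PosDef) (a d : Vec n) :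
    ⟪a + d, act M (a + d)⟫ = ⟪a, act M a⟫ + ⟪act M d, d⟫ + 2 * ⟪act M a, d⟫ := by
  have h1 := inner_act_symm hM a d
  have h2 := real_inner_comm d (act M a)
  have h3 := real_inner_comm d (act M d)
  rw [act_eq_op, map_add, inner_add_left, inner_add_right, inner_add_right]
  simp only [act_eq_op] at *
  linarith

/-- The Taylor expansion of a quadratic function is exact at order two. -/
lemma Data.f0_eq (hQ : P.Q.PosDef) (hU : P.U.PosDef) (x x' : Vec n) (u u' : Vec m) :
    P.f0 x' u' = P.f0 x u + P.quad (x' - x) (u' - u) +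
      (⟪act P.Q (x - P.xd), x' - x⟫ + ⟪act P.U (u - P.ud), u' - u⟫) := by
  have h1 := inner_act_add hQ (x - P.xd) (x' - x)
  have h2 := inner_act_add hU (u - P.ud) (u' - u)
  rw [sub_add_sub_cancel'] at h1 h2
  rw [Data.f0, Data.f0, Data.quad, h1, h2]
  ring

lemma Data.f_sub (x x' : Vec n) (u u' : Vec m) :
    P.f x' u' - P.f x u = act P.A (x' - x) + act P.B (u' - u) := by
  simp only [Data.f, act_eq_actL, map_sub]
  abel

/-- First variation of the cost in terms of a multiplier. In the static problem both terms on the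
right vanish; in the dynamic one they are the derivative of ⟪l, x' - x⟫. -/
lemma Data.cross_eq {x x' l : Vec n} {u u' : Vec m}
    (hB : act P.B.transpose l = act P.U (u - P.ud)) :
    ⟪act P.Q (x - P.xd), x' - x⟫ + ⟪act P.U (u - P.ud), u' - u⟫ =
      ⟪act P.Q (x - P.xd) - act P.A.transpose l, x' - x⟫ + ⟪l, P.f x' u' - P.f x u⟫ := by
  have h : ∀ {k : ℕ} (M : Matrix (Fin n) (Fin k) ℝ) (v : Vec k),
      ⟪act M.transpose l, v⟫ = ⟪l, act M v⟫ := fun M v => by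
    rw [real_inner_comm, ← inner_act, real_inner_comm]
  rw [Data.f_sub, inner_add_right, ← hB, inner_sub_left, h, h]
  ring

lemma Data.isStaticMultiplier_iff (hQ : P.Q.PosDef) (hU : P.U.PosDef) {x l : Vec n} {u : Vec m} :
    P.IsStaticMultiplier x l u ↔ P.f x u = 0 ∧ act P.A.transpose l = act P.Q (x - P.xd) ∧
      act P.B.transpose l = act P.U (u - P.ud) := by
  rw [Data.IsStaticMultiplier, P.gradient_H_costate, P.gradient_H_state hQ,
    P.gradient_H_control hU, neg_eq_zero, sub_eq_zero, sub_eq_zero]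

lemma act_U_inv_cancel (hU : P.U.PosDef) (v : Vec m) : act P.U (act P.U⁻¹ v) = v := by
  rw [act_act, Matrix.mul_nonsing_inv _ ((Matrix.isUnit_iff_isUnit_det _).1 hU.isUnit)]
  simp [act]

lemma act_U_inv_cancel' (hU : P.U.PosDef) (v : Vec m) : act P.U⁻¹ (act P.U v) = v := by
  rw [act_act, Matrix.nonsing_inv_mul _ ((Matrix.isUnit_iff_isUnit_det _).1 hU.isUnit)]
  simp [act]

lemma Data.system_S_apply (hQ : P.Q.PosDef) (hU : P.U.PosDef) (hK : Kalman P.A P.B) (l : Vec n) :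
    (P.system hQ hU hK).S l = act P.B (act P.U⁻¹ (act P.B.transpose l)) := by
  rw [LQSystem.S_apply, ← adjoint_actL]
  rfl

/-- The Hamiltonian operator of a linear-quadratic system is invertible. -/
lemma LQSystem.ham_surjective {V W : Type*} [NormedAddCommGroup V] [InnerProductSpace ℝ V]
    [CompleteSpace V] [NormedAddCommGroup W] [InnerProductSpace ℝ W] [CompleteSpace W]
    [FiniteDimensional ℝ V] (G : LQSystem V W) : Function.Surjective G.ham := by
  refine (ContinuousLinearMap.isUnit_iff_bijective.1
    (LQSystem.isUnit_of_injective fun z hz => ?_)).2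
  rw [LQSystem.ham_apply, Prod.mk_eq_zero] at hz
  -- A kernel element is a constant solution, along which ⟪l, x⟫ does not grow.
  have hsol : G.IsSol (fun _ => z.1) (fun _ => z.2) := fun t =>
    ⟨by rw [hz.1]; exact hasDerivAt_const t _, by rw [hz.2]; exact hasDerivAt_const t _⟩
  have := hsol.eq_zero (a := 0) (b := 1) le_rfl (1 / 2) ⟨by norm_num, by norm_num⟩
  exact Prod.ext this.1 this.2

/-- The static problem has a unique solution with a unique normal multiplier. -/
theorem Data.exists_isUniqueStaticSolution (hQ : P.Q.PosDef) (hU : P.U.PosDef)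
    (hK : Kalman P.A P.B) : ∃ x l u, P.IsUniqueStaticSolution x l u := by
  -- These are the static multiplier equations after substituting u = ud + U⁻¹ B* l.
  obtain ⟨⟨x, l⟩, hxl⟩ := (P.system hQ hU hK).ham_surjective (-act P.B P.ud, act P.Q P.xd)
  rw [LQSystem.ham_apply, Prod.mk.injEq, Data.system_S_apply] at hxl
  set u : Vec m := P.ud + act P.U⁻¹ (act P.B.transpose l) with hu
  have hB : act P.B.transpose l = act P.U (u - P.ud) := by
    rw [hu, add_sub_cancel_left, act_U_inv_cancel hU]
  have hA : act P.A.transpose l = act P.Q (x - P.xd) := by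
    have h2 : act P.Q x - act P.A.transpose l = act P.Q P.xd := by
      rw [← adjoint_op]; exact hxl.2
    rw [act_eq_op P.Q (x - P.xd), map_sub, ← act_eq_op, ← act_eq_op, ← h2, sub_sub_cancel]
  have hf : P.f x u = 0 := by
    have h1 : act P.A x + act P.B (act P.U⁻¹ (act P.B.transpose l)) = -act P.B P.ud := hxl.1
    rw [Data.f, hu, act_eq_actL P.B, map_add, ← act_eq_actL, ← act_eq_actL, add_left_comm, h1,
      add_neg_cancel]
  have hcost : ∀ x' u', P.f x' u' = 0 → P.f0 x' u' = P.f0 x u + P.quad (x' - x) (u' - u) := by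
    intro x' u' hf'
    rw [Data.f0_eq hQ hU x x' u u', Data.cross_eq hB, hA, hf, hf', sub_self, sub_self,
      inner_zero_left, inner_zero_right, add_zero, add_zero]
  refine ⟨x, l, u, ⟨hf, fun x' u' hf' => ?_⟩, (Data.isStaticMultiplier_iff hQ hU).2 ⟨hf, hA, hB⟩,
    fun x' u' h' => ?_, fun l' hl' => ?_⟩
  · rw [hcost x' u' hf']
    linarith [Data.quad_nonneg hQ hU (x' - x) (u' - u)]
  · have h1 := h'.2 x u hf
    rw [hcost x' u' h'.1] at h1
    have h2 := Data.eq_zero_of_quad hQ hU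
      (le_antisymm (by linarith) (Data.quad_nonneg hQ hU (x' - x) (u' - u)))
    exact ⟨sub_eq_zero.1 h2.1, sub_eq_zero.1 h2.2⟩
  · obtain ⟨-, hA', hB'⟩ := (Data.isStaticMultiplier_iff hQ hU).1 hl'
    rw [← sub_eq_zero]
    -- The difference of two multipliers is killed by both A* and B*, hence by every B* (A*)^k.
    refine (P.system hQ hU hK).controllable _ fun k => ?_
    have e1 : ((P.system hQ hU hK).A†) (l' - l) = 0 := by
      change ((op P.A)†) (l' - l) = 0
      rw [map_sub, adjoint_op, adjoint_op, hA, hA', sub_self]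
    have e2 : ((actL P.B)†) (l' - l) = 0 := by
      rw [map_sub, adjoint_actL, adjoint_actL, hB, hB', sub_self]
    rcases k with _ | k
    · exact e2
    · rw [pow_succ, mul_apply_eq_comp, e1, map_zero, map_zero]

end Static

/-! ### Integration by parts for absolutely continuous curves -/

section ByParts

/-- Admissible controls are only essentially bounded, so trajectories are differentiable merely
almost everywhere. The product rule is therefore used in its absolutely continuous form. -/
lemma integral_mul_add_mul_eq_sub {f f' g : ℝ → ℝ} {T c : ℝ}
    (hf : ∀ t, HasDerivAt f (f' t) t) (hf' : Continuous f')
    (hg : IntervalIntegrable g volume 0 T) :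
    IntervalIntegrable (fun t => f' t * (c + ∫ s in (0 : ℝ)..t, g s) + f t * g t) volume 0 T ∧
    ∫ t in (0 : ℝ)..T, (f' t * (c + ∫ s in (0 : ℝ)..t, g s) + f t * g t) =
      f T * (c + ∫ s in (0 : ℝ)..T, g s) - f 0 * c := by
  have hd : deriv f = f' := funext fun t => (hf t).deriv
  have hfc : ContDiff ℝ 1 f :=
    contDiff_one_iff_deriv.2 ⟨fun t => (hf t).differentiableAt, hd ▸ hf'⟩
  have hac : AbsolutelyContinuousOnInterval f 0 T :=
    ContDiffOn.absolutelyContinuousOnInterval hfc.contDiffOn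
  have hGac : AbsolutelyContinuousOnInterval (fun t => c + ∫ s in (0 : ℝ)..t, g s) 0 T := by
    refine AbsolutelyContinuousOnInterval.add (f := fun _ => c) ?_
      (hg.absolutelyContinuousOnInterval_intervalIntegral (by simp))
    exact ContDiffOn.absolutelyContinuousOnInterval contDiff_const.contDiffOn
  constructor
  · exact ((hf'.intervalIntegrable _ _).mul_continuousOn hGac.continuousOn).add
      (hg.continuousOn_mul hac.continuousOn)
  · have h := hac.integral_deriv_mul_eq_sub hGac
    simp only [intervalIntegral.integral_same, add_zero] at h
    rw [← h]
    refine intervalIntegral.integral_congr_ae ?_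
    filter_upwards [hg.ae_hasDerivAt_integral] with t ht htm
    have := (ht (Set.uIoc_subset_uIcc htm) 0 (by simp)).const_add c
    rw [hd, this.deriv]

/-- Integration by parts for an absolutely continuous and a continuously differentiable curve. -/
lemma IsPrimitive.integral_inner_add_inner {k : ℕ} {T : ℝ} (hT : 0 ≤ T) {g y l l' : ℝ → Vec k}
    (hy : IsPrimitive T g y) (hl : ∀ t, HasDerivAt l (l' t) t) (hl' : Continuous l') :
    ∫ t in (0 : ℝ)..T, (⟪l' t, y t⟫ + ⟪l t, g t⟫) = ⟪l T, y T⟫ - ⟪l 0, y 0⟫ := by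
  have hcoord : ∀ i, IntervalIntegrable (fun t => g t i) volume 0 T := fun i =>
    ⟨(EuclideanSpace.proj (𝕜 := ℝ) i).integrable_comp hy.1.1,
      (EuclideanSpace.proj (𝕜 := ℝ) i).integrable_comp hy.1.2⟩
  have hyi : ∀ i, ∀ t ∈ Set.Icc 0 T, y t i = y 0 i + ∫ s in (0 : ℝ)..t, g s i := fun i t ht => by
    have hsub : IntervalIntegrable g volume 0 t :=
      hy.1.mono_set (by
        rw [Set.uIcc_of_le ht.1, Set.uIcc_of_le hT]
        exact Set.Icc_subset_Icc_right ht.2)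
    have := (EuclideanSpace.proj (𝕜 := ℝ) i).intervalIntegral_comp_comm hsub
    rw [hy.2 t ht]
    simp only [EuclideanSpace.coe_proj] at this
    rw [PiLp.add_apply, this]
  have hparts := fun i => integral_mul_add_mul_eq_sub (f := fun t => l t i)
    (f' := fun t => l' t i) (c := y 0 i)
    (fun t => (EuclideanSpace.proj (𝕜 := ℝ) i).hasFDerivAt.comp_hasDerivAt t (hl t))
    ((EuclideanSpace.proj (𝕜 := ℝ) i).continuous.comp hl') (hcoord i)
  have hinner : ∀ a b : Vec k, ⟪a, b⟫ = ∑ i, a i * b i := fun a b => by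
    simp [PiLp.inner_apply, mul_comm]
  calc _ = ∫ t in (0 : ℝ)..T, ∑ i, (l' t i * (y 0 i + ∫ s in (0 : ℝ)..t, g s i) + l t i * g t i) := by
        refine intervalIntegral.integral_congr fun t ht => ?_
        rw [Set.uIcc_of_le hT] at ht
        simp only [hinner, ← Finset.sum_add_distrib]
        exact Finset.sum_congr rfl fun i _ => by rw [hyi i t ht]
    _ = ∑ i, (l T i * y T i - l 0 i * y 0 i) := by
        rw [intervalIntegral.integral_finsetSum fun i _ => (hparts i).1]
        refine Finset.sum_congr rfl fun i _ => ?_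
        rw [(hparts i).2, hyi i T ⟨hT, le_rfl⟩]
    _ = _ := by rw [hinner, hinner, Finset.sum_sub_distrib]

end ByParts

/-! ### Extremals are optimal, and unique -/

section Verification

variable {n m : ℕ} {P : Data n m}

lemma IsPrimitive.sub {k : ℕ} {T : ℝ} (hT : 0 ≤ T) {g y g' y' : ℝ → Vec k}
    (h : IsPrimitive T g y) (h' : IsPrimitive T g' y') :
    IsPrimitive T (fun t => g' t - g t) (fun t => y' t - y t) := by
  refine ⟨h'.1.sub h.1, fun t ht => ?_⟩
  have hs : Set.uIcc 0 t ⊆ Set.uIcc 0 T := by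
    rw [Set.uIcc_of_le ht.1, Set.uIcc_of_le hT]; exact Set.Icc_subset_Icc_right ht.2
  rw [intervalIntegral.integral_sub (h'.1.mono_set hs) (h.1.mono_set hs)]
  simp only [h.2 t ht, h'.2 t ht]
  abel

lemma isPrimitive_of_hasDerivAt {k : ℕ} {T : ℝ} {g y : ℝ → Vec k}
    (h : ∀ t, HasDerivAt y (g t) t) (hg : Continuous g) : IsPrimitive T g y :=
  ⟨hg.intervalIntegrable _ _, fun t _ => by
    rw [intervalIntegral.integral_eq_sub_of_hasDerivAt (fun s _ => h s)
      (hg.intervalIntegrable _ _), add_sub_cancel]⟩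

lemma IsPrimitive.continuousOn {k : ℕ} {T : ℝ} (hT : 0 ≤ T) {g y : ℝ → Vec k}
    (h : IsPrimitive T g y) : ContinuousOn y (Set.Icc 0 T) := by
  have h1 : ContinuousOn (fun t => y 0 + ∫ s in (0 : ℝ)..t, g s) (Set.Icc 0 T) :=
    continuousOn_const.add (by
      have := intervalIntegral.continuousOn_primitive_interval (μ := volume) (f := g) (a := 0) (b := T)
        (by rw [Set.uIcc_of_le hT]; exact (intervalIntegrable_iff_integrableOn_Icc_of_le hT).1 h.1)
      rwa [Set.uIcc_of_le hT] at this)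
  exact h1.congr h.2

lemma memLp_of_continuousOn {k : ℕ} {T : ℝ} {y : ℝ → Vec k} (hy : ContinuousOn y (Set.Icc 0 T)) :
    MemLp y ⊤ (volume.restrict (Set.Icc 0 T)) := by
  obtain ⟨C, hC⟩ := isCompact_Icc.exists_bound_of_continuousOn hy
  exact memLp_top_of_bound (hy.aestronglyMeasurable measurableSet_Icc) C
    ((ae_restrict_iff' measurableSet_Icc).2 (Eventually.of_forall hC))

lemma integrable_inner_act {k : ℕ} (M : Matrix (Fin k) (Fin k) ℝ) {μ : Measure ℝ}
    [IsFiniteMeasure μ] {v : ℝ → Vec k} (hv : MemLp v ⊤ μ) :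
    Integrable (fun t => ⟪v t, act M (v t)⟫) μ := by
  have h2 : MemLp v 2 μ := hv.mono_exponent le_top
  have h3 : MemLp (fun t => act M (v t)) 2 μ := (actL M).comp_memLp' h2
  refine (h2.norm.integrable_mul h3.norm).mono (h2.1.inner h3.1) (Eventually.of_forall fun t => ?_)
  simpa using abs_real_inner_le_norm (v t) (act M (v t))

lemma Data.integrable_quad {μ : Measure ℝ} [IsFiniteMeasure μ] {x : ℝ → Vec n} {u : ℝ → Vec m}
    (hx : MemLp x ⊤ μ) (hu : MemLp u ⊤ μ) : Integrable (fun t => P.quad (x t) (u t)) μ := by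
  unfold Data.quad
  simp only [fun t => real_inner_comm (x t) (act P.Q (x t)),
    fun t => real_inner_comm (u t) (act P.U (u t))]
  exact ((integrable_inner_act P.Q hx).const_mul _).add ((integrable_inner_act P.U hu).const_mul _)

lemma Data.integrable_f0 {μ : Measure ℝ} [IsFiniteMeasure μ] {x : ℝ → Vec n} {u : ℝ → Vec m}
    (hx : MemLp x ⊤ μ) (hu : MemLp u ⊤ μ) : Integrable (fun t => P.f0 (x t) (u t)) μ := by
  unfold Data.f0
  exact ((integrable_inner_act P.Q (hx.sub (memLp_const _))).const_mul _).add
    ((integrable_inner_act P.U (hu.sub (memLp_const _))).const_mul _)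

/-- The equations of a normal extremal, on the whole line and with a continuous control. -/
structure Data.IsExtremalCurve (P : Data n m) (x l : ℝ → Vec n) (u : ℝ → Vec m) : Prop where
  state : ∀ t, HasDerivAt x (P.f (x t) (u t)) t
  costate : ∀ t, HasDerivAt l (act P.Q (x t - P.xd) - act P.A.transpose (l t)) t
  control : ∀ t, act P.B.transpose (l t) = act P.U (u t - P.ud)
  continuous_control : Continuous u

namespace Data.IsExtremalCurve

variable {x l : ℝ → Vec n} {u : ℝ → Vec m}

lemma continuous_state (h : P.IsExtremalCurve x l u) : Continuous x :=
  continuous_iff_continuousAt.2 fun t => (h.state t).continuousAt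

lemma continuous_costate (h : P.IsExtremalCurve x l u) : Continuous l :=
  continuous_iff_continuousAt.2 fun t => (h.costate t).continuousAt

lemma continuous_deriv_state (h : P.IsExtremalCurve x l u) :
    Continuous fun t => P.f (x t) (u t) :=
  ((actL P.A).continuous.comp h.continuous_state).add
    ((actL P.B).continuous.comp h.continuous_control)

lemma continuous_deriv_costate (h : P.IsExtremalCurve x l u) :
    Continuous fun t => act P.Q (x t - P.xd) - act P.A.transpose (l t) :=
  ((actL P.Q).continuous.comp (h.continuous_state.sub continuous_const)).sub
    ((actL P.A.transpose).continuous.comp h.continuous_costate)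

lemma admissible (h : P.IsExtremalCurve x l u) {x₀ : Vec n} {F : FinalCondition n} {T : ℝ}
    (h0 : x 0 = x₀) (hF : F.Holds (x T)) : P.Admissible x₀ F T x u :=
  ⟨memLp_of_continuousOn h.continuous_control.continuousOn, h.continuous_state.continuousOn,
    isPrimitive_of_hasDerivAt h.state h.continuous_deriv_state, h0, hF⟩

lemma isNormalExtremal (hQ : P.Q.PosDef) (hU : P.U.PosDef) (h : P.IsExtremalCurve x l u)
    {F : FinalCondition n} {T : ℝ} (hF : F.Transversal (l T)) : P.IsNormalExtremal F T x l u := by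
  refine ⟨?_, ?_, ?_, hF⟩
  · simp only [P.gradient_H_costate]
    exact isPrimitive_of_hasDerivAt h.state h.continuous_deriv_state
  · simp only [P.gradient_H_state hQ, neg_sub]
    exact isPrimitive_of_hasDerivAt h.costate h.continuous_deriv_costate
  · simp only [P.gradient_H_control hU, h.control, sub_self]
    exact Eventually.of_forall fun _ => trivial

/-- The excess of the cost of an admissible pair over the cost of an extremal curve. -/
lemma cost_eq (hQ : P.Q.PosDef) (hU : P.U.PosDef) (h : P.IsExtremalCurve x l u) {x₀ : Vec n}
    {F : FinalCondition n} {T : ℝ} (hT : 0 ≤ T) (h0 : x 0 = x₀) (hH : F.Holds (x T))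
    (hF : F.Transversal (l T)) {x' : ℝ → Vec n} {u' : ℝ → Vec m}
    (h' : P.Admissible x₀ F T x' u') :
    P.cost T x' u' = P.cost T x u + ∫ t in Set.Icc 0 T, P.quad (x' t - x t) (u' t - u t) := by
  have hadm := h.admissible h0 hH
  have hx := memLp_of_continuousOn hadm.2.1
  have hx' := memLp_of_continuousOn h'.2.1
  have hf := P.integrable_f0 hx hadm.1
  have hf' := P.integrable_f0 hx' h'.1
  have hq := P.integrable_quad (hx'.sub hx) (h'.1.sub hadm.1)
  have hcross := (IsPrimitive.sub hT hadm.2.2.1 h'.2.2.1).integral_inner_add_inner hT h.costate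
    h.continuous_deriv_costate
  have hpt : ∀ t, ⟪act P.Q (x t - P.xd) - act P.A.transpose (l t), x' t - x t⟫ +
      ⟪l t, P.f (x' t) (u' t) - P.f (x t) (u t)⟫ =
      P.f0 (x' t) (u' t) - P.f0 (x t) (u t) - P.quad (x' t - x t) (u' t - u t) := fun t => by
    rw [← P.cross_eq (h.control t), P.f0_eq hQ hU (x t) (x' t) (u t) (u' t)]
    ring
  -- The boundary term at T dies in either case: equal endpoints if the final point is fixed,
  -- transversality if it is free.
  have hend : ⟪l T, x' T - x T⟫ = 0 := by
    have h1 := h'.2.2.2.2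
    cases F with
    | fixed x₁ =>
      have e1 : x' T = x₁ := h1
      have e2 : x T = x₁ := hH
      rw [e1, e2, sub_self, inner_zero_right]
    | free =>
      have e1 : l T = 0 := hF
      rw [e1, inner_zero_left]
  rw [hend, h'.2.2.2.1, h0, sub_self, inner_zero_right, sub_zero,
    intervalIntegral.integral_of_le hT, ← integral_Icc_eq_integral_Ioc] at hcross
  simp only [hpt] at hcross
  have e : ∫ t in Set.Icc 0 T,
      (P.f0 (x' t) (u' t) - P.f0 (x t) (u t) - P.quad (x' t - x t) (u' t - u t)) =
      (∫ t in Set.Icc 0 T, P.f0 (x' t) (u' t)) - (∫ t in Set.Icc 0 T, P.f0 (x t) (u t)) -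
        ∫ t in Set.Icc 0 T, P.quad (x' t - x t) (u' t - u t) := by
    rw [← integral_sub hf' hf]
    exact integral_sub (hf'.sub hf) hq
  rw [Data.cost, Data.cost, intervalIntegral.integral_of_le hT, intervalIntegral.integral_of_le hT,
    ← integral_Icc_eq_integral_Ioc, ← integral_Icc_eq_integral_Ioc]
  linarith

/-- An extremal curve satisfying the boundary conditions is the unique solution. -/
theorem isUniqueSolution (hQ : P.Q.PosDef) (hU : P.U.PosDef) (hK : Kalman P.A P.B)
    (h : P.IsExtremalCurve x l u) {x₀ : Vec n} {F : FinalCondition n} {T : ℝ} (hT : 0 < T)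
    (h0 : x 0 = x₀) (hH : F.Holds (x T)) (hF : F.Transversal (l T)) :
    P.IsUniqueSolution x₀ F T x l u := by
  have hadm := h.admissible h0 hH
  have hcost := fun {x' : ℝ → Vec n} {u' : ℝ → Vec m} (h' : P.Admissible x₀ F T x' u') =>
    h.cost_eq hQ hU hT.le h0 hH hF h'
  have hnn : ∀ (d : ℝ → Vec n) (e : ℝ → Vec m), 0 ≤ fun t => P.quad (d t) (e t) :=
    fun d e t => Data.quad_nonneg hQ hU _ _
  have huniq : ∀ x' u', P.IsOptimal x₀ F T x' u' →
      Set.EqOn x' x (Set.Icc 0 T) ∧ u' =ᵐ[volume.restrict (Set.Icc 0 T)] u := by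
    intro x' u' h'
    have h1 := h'.2 x u hadm
    rw [hcost h'.1] at h1
    have hx := memLp_of_continuousOn hadm.2.1
    have hx' := memLp_of_continuousOn h'.1.2.1
    have hq : Integrable (fun t => P.quad (x' t - x t) (u' t - u t)) _ :=
      P.integrable_quad (hx'.sub hx) (h'.1.1.sub hadm.1)
    have h2 : ∫ t in Set.Icc 0 T, P.quad (x' t - x t) (u' t - u t) = 0 :=
      le_antisymm (by linarith) (integral_nonneg (hnn _ _))
    rw [integral_eq_zero_iff_of_nonneg (hnn _ _) hq] at h2
    have h3 : ∀ᵐ t ∂(volume.restrict (Set.Icc 0 T)), x' t = x t ∧ u' t = u t := by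
      filter_upwards [h2] with t ht
      have := Data.eq_zero_of_quad hQ hU ht
      exact ⟨sub_eq_zero.1 this.1, sub_eq_zero.1 this.2⟩
    exact ⟨Measure.eqOn_Icc_of_ae_eq volume hT.ne (h3.mono fun _ ht => ht.1) h'.1.2.1 hadm.2.1,
      h3.mono fun _ ht => ht.2⟩
  refine ⟨⟨hadm, fun x' u' h' => ?_⟩, h.isNormalExtremal hQ hU hF,
    h.continuous_control.continuousOn, huniq, fun x' l' u' h' hl' => ?_⟩
  · rw [hcost h']
    linarith [integral_nonneg (μ := volume.restrict (Set.Icc 0 T))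
      (hnn (fun t => x' t - x t) (fun t => u' t - u t))]
  · obtain ⟨hx, hu⟩ := huniq x' u' h'
    obtain ⟨-, hprim, hctrl, -⟩ := hl'
    simp only [P.gradient_H_state hQ, neg_sub] at hprim
    simp only [P.gradient_H_control hU] at hctrl
    have hlc := hprim.continuousOn hT.le
    have hdiff := IsPrimitive.sub hT.le
      (isPrimitive_of_hasDerivAt (T := T) h.costate h.continuous_deriv_costate) hprim
    -- The states and controls agree, so the difference of the costates solves the homogeneous
    -- adjoint equation and is annihilated by B*; controllability makes it zero.
    set p : ℝ → Vec n := fun t => l' t - l t with hp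
    have hpc : ContinuousOn p (Set.Icc 0 T) := hlc.sub h.continuous_costate.continuousOn
    have hApc : ContinuousOn (fun t => -act P.A.transpose (p t)) (Set.Icc 0 T) :=
      ((actL P.A.transpose).continuous.comp_continuousOn hpc).neg
    have hpt : ∀ t ∈ Set.Icc 0 T, p t = p 0 + ∫ s in (0 : ℝ)..t, -act P.A.transpose (p s) := by
      intro t ht
      rw [hdiff.2 t ht]
      congr 1
      refine intervalIntegral.integral_congr fun s hs => ?_
      rw [Set.uIcc_of_le ht.1] at hs
      simp only [hx ⟨hs.1, hs.2.trans ht.2⟩, hp, act_eq_actL, map_sub]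
      abel
    have hder : ∀ t ∈ Set.Ioo 0 T, HasDerivAt p (-act P.A.transpose (p t)) t := by
      intro t ht
      have hmem : Set.Icc 0 T ∈ 𝓝 t := Icc_mem_nhds ht.1 ht.2
      have h1 : HasDerivAt (fun t => p 0 + ∫ s in (0 : ℝ)..t, -act P.A.transpose (p s))
          (-act P.A.transpose (p t)) t := by
        refine (intervalIntegral.integral_hasDerivAt_right ?_ ?_ (hApc.continuousAt hmem)).const_add _
        · exact (hApc.mono (by
            rw [Set.uIcc_of_le ht.1.le]
            exact Set.Icc_subset_Icc_right ht.2.le)).intervalIntegrable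
        · exact hApc.stronglyMeasurableAtFilter_nhdsWithin measurableSet_Icc t |>.filter_mono
            (by rw [nhdsWithin_eq_nhds.2 hmem])
      refine h1.congr_of_eventuallyEq ?_
      filter_upwards [hmem] with s hs using hpt s hs
    have hB : ∀ t ∈ Set.Icc 0 T, act P.B.transpose (p t) = 0 := by
      refine Measure.eqOn_Icc_of_ae_eq (f := fun t => act P.B.transpose (p t)) (g := fun _ => 0)
        volume hT.ne ?_ ((actL P.B.transpose).continuous.comp_continuousOn hpc) continuousOn_const
      filter_upwards [hctrl, hu] with t ht hut
      rw [hut, sub_eq_zero, ← h.control t] at ht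
      simp only [hp, act_eq_actL, map_sub] at ht ⊢
      rw [ht, sub_self]
    have hzero : ∀ t ∈ Set.Ioo 0 T, p t = 0 :=
      (P.system hQ hU hK).costate_eq_zero
        (fun t ht => by
          have := hder t ht
          rwa [← adjoint_op] at this)
        (fun t ht => (adjoint_actL _ _).trans (hB t (Set.Ioo_subset_Icc_self ht)))
    have hall : Set.EqOn p (fun _ => 0) (Set.Icc 0 T) := by
      rw [← closure_Ioo hT.ne] at hpc ⊢
      exact Set.EqOn.of_subset_closure hzero hpc continuousOn_const subset_closure le_rfl
    exact fun t ht => sub_eq_zero.1 (hall ht)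

end Data.IsExtremalCurve

end Verification

/-! ### Translation between the matrix and operator formulations -/

section Assembly

variable {n m : ℕ} {P : Data n m}

lemma op_transpose (X : Matrix (Fin n) (Fin n) ℝ) : op X.transpose = (op X)† := by
  ext1 v
  rw [adjoint_op]
  rfl

lemma op_injective : Function.Injective (op (n := n)) := (Matrix.toEuclideanCLM).injective

lemma isSymm_iff_op (X : Matrix (Fin n) (Fin n) ℝ) :
    X.IsSymm ↔ ∀ x y, ⟪op X x, y⟫ = ⟪x, op X y⟫ := by
  rw [Matrix.IsSymm, ← op_injective.eq_iff, op_transpose]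
  constructor
  · intro h x y
    rw [← ContinuousLinearMap.adjoint_inner_right, h]
  · intro h
    ext1 x
    refine ext_inner_right ℝ fun y => ?_
    rw [ContinuousLinearMap.adjoint_inner_left, h]

lemma posDef_of_inner {X : Matrix (Fin n) (Fin n) ℝ} (hX : X.IsSymm)
    (h : ∀ x : Vec n, x ≠ 0 → 0 < ⟪op X x, x⟫) : X.PosDef := by
  refine Matrix.PosDef.of_dotProduct_mulVec_pos (by simpa [Matrix.IsHermitian] using hX.eq)
    fun x hx => ?_
  have := h (WithLp.toLp 2 x) (by simpa using hx)
  simpa [EuclideanSpace.inner_eq_star_dotProduct] using this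

lemma posSemidef_of_inner {X : Matrix (Fin n) (Fin n) ℝ} (hX : X.IsSymm)
    (h : ∀ x : Vec n, 0 ≤ ⟪op X x, x⟫) : X.PosSemidef := by
  refine Matrix.PosSemidef.of_dotProduct_mulVec_nonneg (by simpa [Matrix.IsHermitian] using hX.eq)
    fun x => ?_
  have := h (WithLp.toLp 2 x)
  simpa [EuclideanSpace.inner_eq_star_dotProduct] using this

variable (hQ : P.Q.PosDef) (hU : P.U.PosDef) (hK : Kalman P.A P.B)

lemma Data.op_S : op (P.B * P.U⁻¹ * P.B.transpose) = (P.system hQ hU hK).S := by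
  ext1 v
  rw [P.system_S_apply, act_act, act_act]
  rfl

lemma Data.op_loop (E : Matrix (Fin n) (Fin n) ℝ) :
    op (P.A + P.B * P.U⁻¹ * P.B.transpose * E) = (P.system hQ hU hK).loop (op E) := by
  rw [op, map_add, map_mul, ← op, ← op, P.op_S hQ hU hK]
  rfl

lemma Data.isRiccati_iff (X : Matrix (Fin n) (Fin n) ℝ) :
    P.IsRiccati X ↔ (P.system hQ hU hK).IsRiccati (op X) := by
  refine and_congr (isSymm_iff_op X) ?_
  have h : X * P.B * P.U⁻¹ * P.B.transpose * X = X * ((P.B * P.U⁻¹ * P.B.transpose) * X) := by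
    simp only [Matrix.mul_assoc]
  rw [sub_eq_zero, h, ← op_injective.eq_iff]
  have e : op (X * P.A + P.A.transpose * X + X * ((P.B * P.U⁻¹ * P.B.transpose) * X)) =
      op X * op P.A + (op P.A)† * op X + op X * ((P.system hQ hU hK).S * op X) := by
    rw [← P.op_S, ← op_transpose]
    simp only [op, map_add, map_mul]
  rw [e]
  exact ContinuousLinearMap.ext_iff

/-- The closed loop of a negative definite Riccati solution is stable. -/
lemma Data.re_neg_of_mem_spectrum {E : Matrix (Fin n) (Fin n) ℝ}
    (hE : (P.system hQ hU hK).IsRiccati (op E)) (hneg : ∀ x, x ≠ 0 → ⟪op E x, x⟫ < 0) {μ : ℂ}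
    (hμ : μ ∈ spectrum ℂ (P.closedLoop E)) : μ.re < 0 := by
  obtain ⟨v, hv, h⟩ := mem_spectrum_of_cop.1 hμ
  have hi : ∀ i, (∑ j, ((P.A + P.B * P.U⁻¹ * P.B.transpose * E) i j : ℂ) * v j) = μ * v i :=
    fun i => congrArg (fun w : EuclideanSpace ℂ (Fin n) => w i) h
  -- The real and imaginary parts of a complex eigenvector span a real invariant subspace of the
  -- closed loop.
  refine hE.re_neg hneg (a := WithLp.toLp 2 fun i => (v i).re)
    (b := WithLp.toLp 2 fun i => (v i).im) (α := μ.re) (β := μ.im) ?_ ?_ ?_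
  · by_contra! hab
    refine hv (PiLp.ext fun i => Complex.ext ?_ ?_)
    · exact congrArg (fun w : Vec n => w i) hab.1
    · exact congrArg (fun w : Vec n => w i) hab.2
  · rw [← P.op_loop]
    generalize P.A + P.B * P.U⁻¹ * P.B.transpose * E = M at hi
    ext i
    have := congrArg Complex.re (hi i)
    simpa [Matrix.mulVec, dotProduct] using this
  · rw [← P.op_loop]
    generalize P.A + P.B * P.U⁻¹ * P.B.transpose * E = M at hi
    ext i
    have := congrArg Complex.im (hi i)
    simpa [Matrix.mulVec, dotProduct, add_comm] using this

/-- The spectral abscissa of a matrix of positive size is attained. -/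
lemma exists_isGreatest_re_spectrum (hn : 0 < n) (M : Matrix (Fin n) (Fin n) ℂ) :
    ∃ μ ∈ spectrum ℂ M, IsGreatest (Complex.re '' spectrum ℂ M) μ.re := by
  have : Nonempty (Fin n) := ⟨⟨0, hn⟩⟩
  obtain ⟨μ, hμ, hmax⟩ := Set.exists_max_image (spectrum ℂ M) Complex.re M.finite_spectrum
    (spectrum.nonempty_of_isAlgClosed_of_finiteDimensional ℂ M)
  refine ⟨μ, hμ, ⟨μ, hμ, rfl⟩, ?_⟩
  rintro _ ⟨ν, hν, rfl⟩
  exact hmax ν hν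

/-- Solutions of the Hamiltonian system matching the boundary conditions relative to a steady
state `(xbar, lbar)`, with the turnpike estimate. -/
lemma FinalCondition.exists_solution {G : LQSystem (Vec n) (Vec m)} {E F : Vec n →L[ℝ] Vec n}
    (hE : G.IsRiccati E) (hF : G.IsRiccati F) (hneg : ∀ x, x ≠ 0 → ⟪E x, x⟫ < 0)
    (hpos : ∀ x, x ≠ 0 → 0 < ⟪F x, x⟫) (K : FinalCondition n) (x₀ xbar lbar : Vec n) :
    ∃ X Y : ℝ → ℝ → Vec n,
      (∀ T, 0 < T → G.IsSol (X T) (Y T) ∧ xbar + X T 0 = x₀ ∧ K.Holds (xbar + X T T) ∧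
        K.Transversal (lbar + Y T T)) ∧
      ∀ c, 0 < c → Decays (G.loop E) c → ∀ T₀, (0 < T₀ ∨ (T₀ = 0 ∧ K = FinalCondition.free)) →
        ∃ C, ∀ T, 0 < T → T₀ ≤ T → ∀ t ∈ Set.Icc 0 T,
          ‖X T t‖ + ‖Y T t‖ ≤ C * (Real.exp (-c * t) + Real.exp (-c * (T - t))) := by
  cases K with
  | fixed x₁ =>
    -- Fixed final point: the final condition is on the state v + w. At T = 0 it would repeat the
    -- initial condition, so T₀ = 0 is excluded.
    obtain ⟨X, Y, h, hb⟩ := LQSystem.exists_boundary_solution hE hF hneg hpos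
      (N₁ := ContinuousLinearMap.id ℝ (Vec n)) (N₂ := ContinuousLinearMap.id ℝ (Vec n))
      (fun v w h => Or.inl h) (fun w h => h) (x₀ - xbar) (x₁ - xbar)
    refine ⟨X, Y, fun T hT => ?_, fun c hc hd T₀ hT₀ =>
      hb c hc hd T₀ (hT₀.imp_right fun h => by simp at h)⟩
    obtain ⟨hsol, h0, v, w, h1, -, h2⟩ := h T hT
    refine ⟨hsol, by rw [h0, add_sub_cancel], ?_, trivial⟩
    change xbar + X T T = x₁
    rw [h1]
    exact (congrArg (xbar + ·) h2).trans (add_sub_cancel _ _)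
  | free =>
    -- Free final point: the final condition is on the costate E v + F w. It stays independent of
    -- the initial condition at T = 0 by transversality of the graphs.
    obtain ⟨X, Y, h, hb⟩ := LQSystem.exists_boundary_solution hE hF hneg hpos
      (N₁ := E) (N₂ := F) (fun v w h => Or.inr h)
      (fun w h => by
        by_contra hw
        exact (hpos w hw).ne' (by rw [h, inner_zero_left])) (x₀ - xbar) (-lbar)
    refine ⟨X, Y, fun T hT => ?_, fun c hc hd T₀ hT₀ =>
      hb c hc hd T₀ (hT₀.imp_right fun h => ⟨h.1, fun v w h1 h2 =>
        eq_zero_of_stable_antistable hneg hpos h1 h2⟩)⟩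
    obtain ⟨hsol, h0, v, w, -, h1, h2⟩ := h T hT
    refine ⟨hsol, by rw [h0, add_sub_cancel], trivial, ?_⟩
    change lbar + Y T T = 0
    rw [h1, h2, add_neg_cancel]

/-- The control minimizing the Hamiltonian. -/
def Data.feedback (P : Data n m) (l : Vec n) : Vec m := P.ud + act P.U⁻¹ (act P.B.transpose l)

/-- A steady extremal plus a solution of the homogeneous Hamiltonian system is an extremal. -/
lemma Data.isExtremalCurve_of_isSol {xbar lbar : Vec n} {ubar : Vec m}
    (hbar : P.IsStaticMultiplier xbar lbar ubar) {X Y : ℝ → Vec n}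
    (h : (P.system hQ hU hK).IsSol X Y) :
    P.IsExtremalCurve (fun t => xbar + X t) (fun t => lbar + Y t)
      (fun t => P.feedback (lbar + Y t)) := by
  obtain ⟨hf, hA, hB⟩ := (Data.isStaticMultiplier_iff hQ hU).1 hbar
  have hY : Continuous Y := continuous_iff_continuousAt.2 fun t => (h t).2.continuousAt
  refine ⟨fun t => ((h t).1.const_add xbar).congr_deriv ?_,
    fun t => ((h t).2.const_add lbar).congr_deriv ?_, fun t => ?_, ?_⟩
  · have hu : P.feedback (lbar + Y t) = ubar + act P.U⁻¹ (act P.B.transpose (Y t)) := by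
      have : act P.U⁻¹ (act P.B.transpose lbar) = ubar - P.ud := by
        rw [hB, act_U_inv_cancel' hU]
      simp only [Data.feedback, act_eq_actL, map_add] at this ⊢
      rw [this]
      abel
    rw [P.system_S_apply, hu]
    change act P.A (X t) + _ = _
    have e := P.f_sub xbar (xbar + X t) ubar (ubar + act P.U⁻¹ (act P.B.transpose (Y t)))
    rw [hf, sub_zero, add_sub_cancel_left, add_sub_cancel_left] at e
    exact e.symm
  · change act P.Q (X t) - ((op P.A)†) (Y t) = _
    rw [adjoint_op, add_sub_right_comm]
    simp only [act_eq_actL, map_add] at hA ⊢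
    rw [hA]
    abel
  · simp only [Data.feedback, add_sub_cancel_left]
    rw [act_U_inv_cancel hU]
  · exact continuous_const.add ((actL P.U⁻¹).continuous.comp
      ((actL P.B.transpose).continuous.comp (continuous_const.add hY)))

end Assembly

end LQTurnpike

end

/-! ### The turnpike theorem -/

open LQTurnpike

theorem theorem2 {n m : ℕ} (hn : 0 < n) (P : LQTurnpike.Data n m)
    (hQ : P.Q.PosDef) (hU : P.U.PosDef) (hK : LQTurnpike.Kalman P.A P.B)
    (x₀ : LQTurnpike.Vec n) (F : LQTurnpike.FinalCondition n) :
    ∃ (E : Matrix (Fin n) (Fin n) ℝ) (σ : ℝ)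
      (xbar lbar : LQTurnpike.Vec n) (ubar : LQTurnpike.Vec m)
      (x l : ℝ → ℝ → LQTurnpike.Vec n) (u : ℝ → ℝ → LQTurnpike.Vec m),
      P.IsEMinus E ∧
      0 < σ ∧ IsGreatest (Complex.re '' spectrum ℂ (P.closedLoop E)) (-σ) ∧
      P.IsUniqueStaticSolution xbar lbar ubar ∧
      (∀ T : ℝ, 0 < T → P.IsUniqueSolution x₀ F T (x T) (l T) (u T)) ∧
      ∀ C₂ : ℝ, 0 < C₂ →
        (C₂ < σ ∨ (C₂ = σ ∧ ∀ μ ∈ spectrum ℂ (P.closedLoop E), μ.re = -σ →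
          LQTurnpike.IsSemisimpleAt (P.closedLoop E) μ)) →
        ∀ T₀ : ℝ, (0 < T₀ ∨ (T₀ = 0 ∧ F = LQTurnpike.FinalCondition.free)) →
          ∃ C₁ : ℝ, 0 < C₁ ∧ ∀ T : ℝ, 0 < T → T₀ ≤ T → ∀ t ∈ Set.Icc 0 T,
            ‖x T t - xbar‖ + ‖l T t - lbar‖ + ‖u T t - ubar‖
              ≤ C₁ * (Real.exp (-C₂ * t) + Real.exp (-C₂ * (T - t))) := by
  obtain ⟨E', hE', hneg⟩ := (P.system hQ hU hK).exists_isRiccati_neg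
  obtain ⟨F', hF', hpos⟩ := (P.system hQ hU hK).exists_isRiccati_pos
  obtain ⟨E, rfl⟩ : ∃ E : Matrix (Fin n) (Fin n) ℝ, op E = E' :=
    (Matrix.toEuclideanCLM (n := Fin n) (𝕜 := ℝ)).surjective E'
  obtain ⟨μ₀, hμ₀, hmax⟩ := exists_isGreatest_re_spectrum hn (P.closedLoop E)
  have hσ : μ₀.re < 0 := Data.re_neg_of_mem_spectrum hQ hU hK hE' hneg hμ₀
  have hle : ∀ μ ∈ spectrum ℂ (P.closedLoop E), μ.re ≤ μ₀.re := fun μ hμ => hmax.2 ⟨μ, hμ, rfl⟩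
  have hdecay : ∀ c, (∀ μ ∈ spectrum ℂ (P.closedLoop E), μ.re < -c ∨
      (μ.re = -c ∧ IsSemisimpleAt (P.closedLoop E) μ)) →
      Decays ((P.system hQ hU hK).loop (op E)) c := fun c h => by
    rw [← P.op_loop hQ hU hK]
    exact decays_op h
  have hER : P.IsRiccati E := (P.isRiccati_iff hQ hU hK E).2 hE'
  have hmin : ∀ X, P.IsRiccati X → (X - E).PosSemidef := fun X hX => by
    refine posSemidef_of_inner (hX.1.sub hER.1) fun v => ?_
    rw [op, map_sub]
    -- Minimality needs some positive decay rate only; half the spectral gap avoids any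
    -- semisimplicity requirement.
    exact hE'.inner_sub_nonneg ((P.isRiccati_iff hQ hU hK X).1 hX) (c := -μ₀.re / 2)
      (by linarith) (hdecay _ fun μ hμ => Or.inl (by linarith [hle μ hμ])) v
  obtain ⟨xbar, lbar, ubar, hstat⟩ := P.exists_isUniqueStaticSolution hQ hU hK
  obtain ⟨X, Y, hXY, hbound⟩ := F.exists_solution hE' hF' hneg hpos x₀ xbar lbar
  have hub : ubar = P.feedback lbar := by
    obtain ⟨-, -, hB⟩ := (Data.isStaticMultiplier_iff hQ hU).1 hstat.2.1
    rw [Data.feedback, hB, act_U_inv_cancel' hU, add_sub_cancel]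
  refine ⟨E, -μ₀.re, xbar, lbar, ubar, fun T t => xbar + X T t, fun T t => lbar + Y T t,
    fun T t => P.feedback (lbar + Y T t), ⟨hER, ?_, hmin⟩, by linarith, by rwa [neg_neg], hstat,
    fun T hT => ?_, fun C₂ hC₂ hC T₀ hT₀ => ?_⟩
  · refine posDef_of_inner hER.1.neg fun v hv => ?_
    rw [op, map_neg]
    simpa using hneg v hv
  · obtain ⟨hsol, h0, hH, hT'⟩ := hXY T hT
    exact (Data.isExtremalCurve_of_isSol hQ hU hK hstat.2.1 hsol).isUniqueSolution hQ hU hK hT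
      h0 hH hT'
  · obtain ⟨C, hCb⟩ := hbound C₂ hC₂ (hdecay C₂ fun μ hμ => by
      -- At the critical rate, semisimplicity is invoked only for eigenvalues on the line Re μ = -σ;
      -- the others lie strictly to its left.
      rcases hC with h | ⟨rfl, h⟩
      · exact Or.inl (by linarith [hle μ hμ])
      · rcases (hle μ hμ).lt_or_eq with h' | h'
        · exact Or.inl (by linarith)
        · exact Or.inr ⟨by linarith, h μ hμ (by linarith)⟩) T₀ hT₀
    let L : Vec n →L[ℝ] Vec m := (actL P.U⁻¹) ∘L (actL P.B.transpose)
    -- The control deviation is `L` applied to the costate deviation, whence the factor 1 + ‖L‖; the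
    -- absolute value and the added 1 make the constant positive.
    refine ⟨(1 + ‖L‖) * |C| + 1, by positivity, fun T hT hTT t ht => ?_⟩
    have hu : P.feedback (lbar + Y T t) - ubar = L (Y T t) := by
      rw [hub]
      simp only [Data.feedback, act_eq_actL, map_add, L, ContinuousLinearMap.comp_apply]
      abel
    simp only [add_sub_cancel_left]
    rw [hu]
    have h1 := hCb T hT hTT t ht
    have h2 := L.le_opNorm (Y T t)
    set e := Real.exp (-C₂ * t) + Real.exp (-C₂ * (T - t)) with he
    have hepos : 0 < e := by positivity
    calc _ ≤ (1 + ‖L‖) * (‖X T t‖ + ‖Y T t‖) := by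
          nlinarith [norm_nonneg L, norm_nonneg (X T t)]
      _ ≤ (1 + ‖L‖) * (|C| * e) := by
          gcongr
          exact h1.trans (by gcongr; exact le_abs_self C)
      _ ≤ _ := by nlinarith
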